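/- Let $V$ be a finite-dimensional complex vector space and let $G\le GL(V)$ be an irreducible finite complex reflection group, i.e. $G$ is finite, acts irreducibly on $V$, and is generated by the set $\mathcal S=\{s\in G:\dim(1-s)V=1\}$ of its complex reflections. For $s\in\mathcal S$ choose a root $\alpha_s\in V^*$ and a coroot $\check\alpha_s\in V$ such that $s(v)=v-\langle\alpha_s,v\rangle\check\alpha_s$ for all $v\in V$. Let $c\colon\mathcal S\to\mathbb C$, $s\mapsto c_s$, satisfy $c_{gsg^{-1}}=c_s$ for all $g\in G$, $s\in\mathcal S$. The algebra $H_{0,c}(G)$ is generated by $V$, $G$ and $V^*$ with the relations of $G$ and, for $v,v'\in V$, $f,f'\in V^*$, $g\in G$, the relations $[v,v']=0$, $[f,f']=0$, $gv=g(v)g$, $gf=g(f)g$ and $[f,v]=\sum_{s\in\mathcal S}c_s\langle f,(1-s)v\rangle s$. The restricted Cherednik algebra is $\overline H_{0,c}(G)=H_{0,c}(G)/\langle S(V)^G_+,S(V^*)^G_+\rangle$, where $S(V)^G_+$ denotes the $G$-invariants in $S(V)$ with zero constant term, and the coinvariant algebra is $S(V)_G=S(V)/\langle S(V)^G_+\rangle$.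 Let $Y_G$ be the vector space with basis $\{[s]:s\in\mathcal S\}$, with $G$-action $g([s])=\lambda(g,s)[gsg^{-1}]$, where $g(\check\alpha_s)=\lambda(g,s)\check\alpha_{gsg^{-1}}$, and with braiding $\Psi([r]\otimes[s])=r([s])\otimes[r]$; let $\{[s]^*\}$ be the dual basis of $Y_G^*$, with the contragredient $G$-action and the adjoint braiding $\Psi^*$ (for the pairing $\langle f\otimes f',y\otimes y'\rangle=\langle f,y\rangle\langle f',y'\rangle$). For a braided space $(Y,\Psi)$ put $[n]_\Psi=\mathrm{id}+\Psi_{n-1,n}+\Psi_{n-1,n}\Psi_{n-2,n-1}+\dots+\Psi_{n-1,n}\cdots\Psi_{1,2}$ and $[n]!_\Psi=([1]_\Psi\otimes\mathrm{id}^{\otimes n-1})([2]_\Psi\otimes\mathrm{id}^{\otimes n-2})\cdots[n]_\Psi$ on $Y^{\otimes n}$, and let $\mathcal B(Y)=T(Y)/\bigoplus_n\ker[n]!_\Psi$ be the Nichols–Woronowicz algebra. The braided Heisenberg double $\mathcal H_{Y_G}$ is the algebra generated by $[s]$, $[s]^*$ ($s\in\mathcal S$) and $G$, with the relations of $G$,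 of $\mathcal B(Y_G)$ among the $[s]$, and of $\mathcal B(Y_G^*)$ among the $[s]^*$, together with $g\cdot[s]=g([s])\cdot g$, $g\cdot[s]^*=g([s]^*)\cdot g$, and $[r]^*[s]-[s][r]^*=s$ if $r=s$ and $0$ otherwise. Then the assignment $$M_c(v)=\sum_{s\in\mathcal S}c_s\langle\alpha_s,v\rangle[s],\qquad M_c(f)=\sum_{s\in\mathcal S}\langle f,\check\alpha_s\rangle[s]^*,\qquad M_c(g)=g\qquad(v\in V,\ f\in V^*,\ g\in G)$$ extends to an algebra homomorphism $M_c\colon\overline H_{0,c}(G)\to\mathcal H_{Y_G}$. For generic $c$ the homomorphism $M_c$ is injective: namely if $c_s\ne0$ for all $s\in\mathcal S$ and, more generally, if the reflections $s$ with $c_s\neq 0$ generate $G$. In particular, the map $v\mapsto\sum_{s}c_s\langle\alpha_s,v\rangle[s]$ extends to an algebra homomorphism $S(V)_G\to\mathcal B(Y_G)$, which is injective under the same condition on $c$, so that the coinvariant algebra embeds in $\mathcal B(Y_G)$. -/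

import Mathlib

noncomputable section

namespace Cherednik

open scoped Matrix

/-! ### Braidings in coordinates and Nichols-Woronowicz algebras -/

section Braided

variable {ι : Type*} [Fintype ι] [DecidableEq ι]

/-- Leg notation. A linear endomorphism `Ψ` of `Y ⊗ Y`, where `Y` has basis `e_i` (`i : ι`), is
given by its matrix: `Ψ (e_i ⊗ e_j) = ∑ Ψ (k, l) (i, j) e_k ⊗ e_l`. The `n`-th tensor power of `Y`
has as basis the words `w : Fin n → ι`, and `leg Ψ n p q` is the matrix of `Ψ` applied at the
tensor positions `p` and `q`. -/
def leg (Ψ : Matrix (ι × ι) (ι × ι) ℂ) (n : ℕ) (p q : Fin n) :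
    Matrix (Fin n → ι) (Fin n → ι) ℂ :=
  Matrix.of fun u w =>
    if ∀ k : Fin n, k ≠ p → k ≠ q → u k = w k then Ψ (u p, u q) (w p, w q) else 0

/-- `Ψ` applied at the (zero-based) positions `i`, `i + 1` of the `n`-th tensor power. Positions
that do not exist are never used below. -/
def adjLeg (Ψ : Matrix (ι × ι) (ι × ι) ℂ) (n i : ℕ) : Matrix (Fin n → ι) (Fin n → ι) ℂ :=
  if h : i + 1 < n then leg Ψ n ⟨i, Nat.lt_of_succ_lt h⟩ ⟨i + 1, h⟩ else 1

/-- The braided integer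
`[m] = 1 + Ψ_{m-1,m} + Ψ_{m-1,m} Ψ_{m-2,m-1} + ⋯ + Ψ_{m-1,m} ⋯ Ψ_{1,2}` (one-based positions),
acting on the first `m` tensor factors of the `n`-th tensor power. -/
def braidedInt (Ψ : Matrix (ι × ι) (ι × ι) ℂ) (n m : ℕ) : Matrix (Fin n → ι) (Fin n → ι) ℂ :=
  ∑ k ∈ Finset.range m, ((List.range k).map fun j => adjLeg Ψ n (m - 2 - j)).prod

/-- The braided factorial `[n]! = ([1] ⊗ id) ([2] ⊗ id) ⋯ [n]`, which is the degree `n` component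
of the Woronowicz symmetriser of `Ψ`. -/
def braidedFactorial (Ψ : Matrix (ι × ι) (ι × ι) ℂ) (n : ℕ) :
    Matrix (Fin n → ι) (Fin n → ι) ℂ :=
  ((List.range n).map fun m => braidedInt Ψ n (m + 1)).prod

/-- The noncommutative homogeneous polynomial `∑ a_w x_{w_1} ⋯ x_{w_n}`. -/
def wordSum {A : Type*} [Ring A] [Algebra ℂ A] (x : ι → A) {n : ℕ} (a : (Fin n → ι) → ℂ) : A :=
  ∑ w : Fin n → ι, a w • (List.ofFn fun k => x (w k)).prod

/-- The relations of the Nichols-Woronowicz algebra: the (graded) kernel of the Woronowicz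
symmetriser in the tensor algebra, i.e. in the free algebra on the basis. -/
inductive NicholsRel (Ψ : Matrix (ι × ι) (ι × ι) ℂ) : FreeAlgebra ℂ ι → FreeAlgebra ℂ ι → Prop
  | ker (n : ℕ) (a : (Fin n → ι) → ℂ) (h : braidedFactorial Ψ n *ᵥ a = 0) :
      NicholsRel Ψ (wordSum (FreeAlgebra.ι ℂ) a) 0

/-- The Nichols-Woronowicz algebra of the space with basis `ι` and braiding `Ψ`. -/
abbrev Nichols (Ψ : Matrix (ι × ι) (ι × ι) ℂ) := RingQuot (NicholsRel Ψ)

/-- The generator of the Nichols-Woronowicz algebra given by a basis vector. -/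
def Nichols.gen (Ψ : Matrix (ι × ι) (ι × ι) ℂ) (i : ι) : Nichols Ψ :=
  RingQuot.mkAlgHom ℂ (NicholsRel Ψ) (FreeAlgebra.ι ℂ i)

end Braided

/-! ### Coinvariant algebras -/

section Coinvariants

variable {Γ W : Type*} [Group Γ] [AddCommGroup W] [Module ℂ W]

/-- The action of a group element on the symmetric algebra of a representation. -/
def symAct (ρ : Representation ℂ Γ W) (g : Γ) :
    SymmetricAlgebra ℂ W →ₐ[ℂ] SymmetricAlgebra ℂ W :=
  SymmetricAlgebra.lift (SymmetricAlgebra.ι ℂ W ∘ₗ ρ g)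

/-- The invariants in the symmetric algebra with zero constant term. -/
def posInvariants (ρ : Representation ℂ Γ W) : Set (SymmetricAlgebra ℂ W) :=
  {p | (∀ g, symAct ρ g p = p) ∧ SymmetricAlgebra.algebraMapInv p = 0}

/-- The coinvariant algebra: the symmetric algebra modulo the ideal generated by the invariants
with zero constant term. -/
abbrev Coinvariant (ρ : Representation ℂ Γ W) :=
  SymmetricAlgebra ℂ W ⧸ Ideal.span (posInvariants ρ)

end Coinvariants

/-! ### Complex reflections -/

variable {V : Type*} [AddCommGroup V] [Module ℂ V]

/-- The tautological representation of a linear group. -/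
def natRep (G : Subgroup (LinearMap.GeneralLinearGroup ℂ V)) : Representation ℂ G V :=
  (Units.coeHom (V →ₗ[ℂ] V)).comp G.subtype

/-- `s` is a complex reflection: `dim (1 - s) V = 1`. -/
def IsReflection {G : Subgroup (LinearMap.GeneralLinearGroup ℂ V)} (s : G) : Prop :=
  Module.finrank ℂ (LinearMap.range (1 - natRep G s)) = 1

/-- The set of complex reflections in `G`. -/
def Refl (G : Subgroup (LinearMap.GeneralLinearGroup ℂ V)) := {s : G // IsReflection s}

instance (G : Subgroup (LinearMap.GeneralLinearGroup ℂ V)) : DecidableEq (Refl G) :=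
  Classical.decEq _

instance (G : Subgroup (LinearMap.GeneralLinearGroup ℂ V)) [Finite G] : Fintype (Refl G) :=
  @Fintype.ofFinite _ (inferInstanceAs (Finite {s : G // IsReflection s}))

variable {G : Subgroup (LinearMap.GeneralLinearGroup ℂ V)}

theorem IsReflection.conj {s : G} (hs : IsReflection s) (g : G) : IsReflection (g * s * g⁻¹) := by
  have key : (1 - natRep G (g * s * g⁻¹) : V →ₗ[ℂ] V)
      = natRep G g ∘ₗ (1 - natRep G s) ∘ₗ natRep G g⁻¹ := by
    change _ = natRep G g * ((1 - natRep G s) * natRep G g⁻¹)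
    rw [sub_mul, mul_sub, one_mul, ← map_mul, ← map_mul, ← map_mul, mul_inv_cancel, map_one,
      mul_assoc]
  have hinv : ∀ h : G, natRep G h ∘ₗ natRep G h⁻¹ = LinearMap.id := fun h => by
    change natRep G h * natRep G h⁻¹ = 1
    rw [← map_mul, mul_inv_cancel, map_one]
  have hinj : Function.Injective (natRep G g) := by
    have h := hinv g⁻¹
    rw [inv_inv] at h
    exact Function.LeftInverse.injective (g := natRep G g⁻¹) fun v => LinearMap.congr_fun h v
  have hsurj : Function.Surjective (natRep G g⁻¹) := by
    have h := hinv g⁻¹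
    rw [inv_inv] at h
    exact Function.RightInverse.surjective (g := natRep G g) fun v => LinearMap.congr_fun h v
  unfold IsReflection at hs ⊢
  rw [key, LinearMap.range_comp, LinearMap.range_comp_of_range_eq_top _
    (LinearMap.range_eq_top.2 hsurj), ← hs]
  exact (Submodule.equivMapOfInjective _ hinj _).finrank_eq.symm

/-- The conjugate `g s g⁻¹` of a complex reflection. -/
def Refl.conj (g : G) (s : Refl G) : Refl G := ⟨g * s.1 * g⁻¹, s.2.conj g⟩

variable (G) in
/-- A choice of roots `α_s ∈ V*` and coroots `α̌_s ∈ V` of all complex reflections: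
`s(v) = v - ⟨α_s, v⟩ α̌_s`. -/
structure RootData where
  /-- the root `α_s` -/
  root : Refl G → Module.Dual ℂ V
  /-- the coroot `α̌_s` -/
  coroot : Refl G → V
  /-- the defining property -/
  apply_eq : ∀ (s : Refl G) (v : V), natRep G s.1 v = v - root s v • coroot s

namespace RootData

variable (R : RootData G)

theorem exists_cocycle (g : G) (s : Refl G) :
    ∃ l : ℂ, natRep G g (R.coroot s) = l • R.coroot (s.conj g) := by
  have hne : ∃ v, R.root s v ≠ 0 := by
    by_contra! h
    have h0 : (1 - natRep G s.1 : V →ₗ[ℂ] V) = 0 := by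
      ext v
      simp [R.apply_eq, h]
    have hs : Module.finrank ℂ (LinearMap.range (1 - natRep G s.1)) = 1 := s.2
    rw [h0, LinearMap.range_zero, finrank_bot] at hs
    exact zero_ne_one hs
  obtain ⟨v, hv⟩ := hne
  refine ⟨(R.root s v)⁻¹ * R.root (s.conj g) (natRep G g v), ?_⟩
  have h1 := R.apply_eq (s.conj g) (natRep G g v)
  have h2 : natRep G (s.conj g).1 (natRep G g v) = natRep G g (natRep G s.1 v) := by
    change (natRep G (g * s.1 * g⁻¹) * natRep G g) v = (natRep G g * natRep G s.1) v
    rw [← map_mul, ← map_mul, inv_mul_cancel_right]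
  rw [h2, R.apply_eq s v, map_sub, map_smul, sub_right_inj] at h1
  rw [mul_smul, ← h1, inv_smul_smul₀ hv]

/-- The scalar `λ(g, s)` with `g(α̌_s) = λ(g, s) α̌_{g s g⁻¹}`. -/
def cocycle (g : G) (s : Refl G) : ℂ := (R.exists_cocycle g s).choose

theorem cocycle_spec (g : G) (s : Refl G) :
    natRep G g (R.coroot s) = R.cocycle g s • R.coroot (s.conj g) :=
  (R.exists_cocycle g s).choose_spec

/-- The Yetter-Drinfeld module `Y_G` has basis `[s]`, indexed by the complex reflections, with
`[s]` in degree `s` and action `g([s]) = λ(g, s) [g s g⁻¹]`. This is the matrix of its braiding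
`Ψ ([r] ⊗ [s]) = r([s]) ⊗ [r] = λ(r, s) [r s r⁻¹] ⊗ [r]`. -/
def braiding : Matrix (Refl G × Refl G) (Refl G × Refl G) ℂ :=
  Matrix.of fun kl rs =>
    if kl.1 = rs.2.conj rs.1.1 ∧ kl.2 = rs.1 then R.cocycle rs.1.1 rs.2 else 0

end RootData

/-! ### The braided Heisenberg double of `Y_G` -/

variable (G) in
/-- Generators of the braided Heisenberg double: `[s]`, the group elements, and the elements
`[s]*` of the dual basis. -/
inductive HeisGen
  | y (s : Refl G)
  | grp (g : G)
  | ystar (s : Refl G)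

/-- Defining relations of the braided Heisenberg double `B(Y_G) ⋊ ℂG ⋉ B(Y_G*)`. In the dual basis
`[s]*` the adjoint braiding `Ψ*` on `Y_G*` has the transposed matrix, and the contragredient action
is `g([s]*) = λ(g, s)⁻¹ [g s g⁻¹]*`. -/
inductive HeisRel [Finite G] (R : RootData G) :
    FreeAlgebra ℂ (HeisGen G) → FreeAlgebra ℂ (HeisGen G) → Prop
  | ker (n : ℕ) (a : (Fin n → Refl G) → ℂ) (h : braidedFactorial R.braiding n *ᵥ a = 0) :
      HeisRel R (wordSum (fun s => FreeAlgebra.ι ℂ (HeisGen.y s)) a) 0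
  | ker_star (n : ℕ) (a : (Fin n → Refl G) → ℂ) (h : braidedFactorial R.braidingᵀ n *ᵥ a = 0) :
      HeisRel R (wordSum (fun s => FreeAlgebra.ι ℂ (HeisGen.ystar s)) a) 0
  | grp_one : HeisRel R (FreeAlgebra.ι ℂ (.grp 1)) 1
  | grp_mul (g h : G) :
      HeisRel R (FreeAlgebra.ι ℂ (.grp (g * h)))
        (FreeAlgebra.ι ℂ (.grp g) * FreeAlgebra.ι ℂ (.grp h))
  | grp_y (g : G) (s : Refl G) :
      HeisRel R (FreeAlgebra.ι ℂ (.grp g) * FreeAlgebra.ι ℂ (.y s))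
        (R.cocycle g s • (FreeAlgebra.ι ℂ (.y (s.conj g)) * FreeAlgebra.ι ℂ (.grp g)))
  | grp_ystar (g : G) (s : Refl G) :
      HeisRel R (FreeAlgebra.ι ℂ (.grp g) * FreeAlgebra.ι ℂ (.ystar s))
        ((R.cocycle g s)⁻¹ • (FreeAlgebra.ι ℂ (.ystar (s.conj g)) * FreeAlgebra.ι ℂ (.grp g)))
  | comm (r s : Refl G) :
      HeisRel R
        (FreeAlgebra.ι ℂ (.ystar r) * FreeAlgebra.ι ℂ (.y s)
          - FreeAlgebra.ι ℂ (.y s) * FreeAlgebra.ι ℂ (.ystar r))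
        (if r = s then FreeAlgebra.ι ℂ (.grp s.1) else 0)

/-- The braided Heisenberg double attached to `Y_G`. -/
abbrev HeisDouble [Finite G] (R : RootData G) := RingQuot (HeisRel R)

namespace HeisDouble

variable [Finite G] (R : RootData G)

/-- The generator `[s]`. -/
def y (s : Refl G) : HeisDouble R := RingQuot.mkAlgHom ℂ (HeisRel R) (FreeAlgebra.ι ℂ (.y s))

/-- The generator `[s]*`. -/
def ystar (s : Refl G) : HeisDouble R :=
  RingQuot.mkAlgHom ℂ (HeisRel R) (FreeAlgebra.ι ℂ (.ystar s))

/-- The group element `g`. -/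
def grp (g : G) : HeisDouble R := RingQuot.mkAlgHom ℂ (HeisRel R) (FreeAlgebra.ι ℂ (.grp g))

end HeisDouble

/-! ### Rational and restricted Cherednik algebras -/

variable (G) in
/-- Generators of the rational Cherednik algebra: vectors, group elements, linear forms. -/
inductive CherGen
  | vec (v : V)
  | grp (g : G)
  | cov (f : Module.Dual ℂ V)

/-- Defining relations of the rational Cherednik algebra `H_{t,c}(G)`. -/
inductive CherRel [Finite G] (t : ℂ) (c : Refl G → ℂ) :
    FreeAlgebra ℂ (CherGen G) → FreeAlgebra ℂ (CherGen G) → Prop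
  | vec_add (v w : V) :
      CherRel t c (FreeAlgebra.ι ℂ (.vec (v + w)))
        (FreeAlgebra.ι ℂ (.vec v) + FreeAlgebra.ι ℂ (.vec w))
  | vec_smul (z : ℂ) (v : V) :
      CherRel t c (FreeAlgebra.ι ℂ (.vec (z • v))) (z • FreeAlgebra.ι ℂ (.vec v))
  | cov_add (f f' : Module.Dual ℂ V) :
      CherRel t c (FreeAlgebra.ι ℂ (.cov (f + f')))
        (FreeAlgebra.ι ℂ (.cov f) + FreeAlgebra.ι ℂ (.cov f'))
  | cov_smul (z : ℂ) (f : Module.Dual ℂ V) :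
      CherRel t c (FreeAlgebra.ι ℂ (.cov (z • f))) (z • FreeAlgebra.ι ℂ (.cov f))
  | grp_one : CherRel t c (FreeAlgebra.ι ℂ (.grp 1)) 1
  | grp_mul (g h : G) :
      CherRel t c (FreeAlgebra.ι ℂ (.grp (g * h)))
        (FreeAlgebra.ι ℂ (.grp g) * FreeAlgebra.ι ℂ (.grp h))
  | vec_comm (v w : V) :
      CherRel t c (FreeAlgebra.ι ℂ (.vec v) * FreeAlgebra.ι ℂ (.vec w))
        (FreeAlgebra.ι ℂ (.vec w) * FreeAlgebra.ι ℂ (.vec v))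
  | cov_comm (f f' : Module.Dual ℂ V) :
      CherRel t c (FreeAlgebra.ι ℂ (.cov f) * FreeAlgebra.ι ℂ (.cov f'))
        (FreeAlgebra.ι ℂ (.cov f') * FreeAlgebra.ι ℂ (.cov f))
  | grp_vec (g : G) (v : V) :
      CherRel t c (FreeAlgebra.ι ℂ (.grp g) * FreeAlgebra.ι ℂ (.vec v))
        (FreeAlgebra.ι ℂ (.vec (natRep G g v)) * FreeAlgebra.ι ℂ (.grp g))
  | grp_cov (g : G) (f : Module.Dual ℂ V) :
      CherRel t c (FreeAlgebra.ι ℂ (.grp g) * FreeAlgebra.ι ℂ (.cov f))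
        (FreeAlgebra.ι ℂ (.cov ((natRep G).dual g f)) * FreeAlgebra.ι ℂ (.grp g))
  | cov_vec (f : Module.Dual ℂ V) (v : V) :
      CherRel t c
        (FreeAlgebra.ι ℂ (.cov f) * FreeAlgebra.ι ℂ (.vec v)
          - FreeAlgebra.ι ℂ (.vec v) * FreeAlgebra.ι ℂ (.cov f))
        (algebraMap ℂ _ (t * f v)
          + ∑ s : Refl G, (c s * f (v - natRep G s.1 v)) • FreeAlgebra.ι ℂ (.grp s.1))

/-- The rational Cherednik algebra `H_{t,c}(G)`. -/
abbrev RatCher [Finite G] (t : ℂ) (c : Refl G → ℂ) := RingQuot (CherRel t c)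

namespace RatCher

variable [Finite G] (t : ℂ) (c : Refl G → ℂ)

/-- The linear map `V → H_{t,c}(G)`. -/
def vec : V →ₗ[ℂ] RatCher t c where
  toFun v := RingQuot.mkAlgHom ℂ (CherRel t c) (FreeAlgebra.ι ℂ (.vec v))
  map_add' v w := by rw [RingQuot.mkAlgHom_rel ℂ (CherRel.vec_add v w), map_add]
  map_smul' z v := by
    rw [RingQuot.mkAlgHom_rel ℂ (CherRel.vec_smul z v), map_smul, RingHom.id_apply]

/-- The linear map `V* → H_{t,c}(G)`. -/
def cov : Module.Dual ℂ V →ₗ[ℂ] RatCher t c where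
  toFun f := RingQuot.mkAlgHom ℂ (CherRel t c) (FreeAlgebra.ι ℂ (.cov f))
  map_add' f f' := by rw [RingQuot.mkAlgHom_rel ℂ (CherRel.cov_add f f'), map_add]
  map_smul' z f := by
    rw [RingQuot.mkAlgHom_rel ℂ (CherRel.cov_smul z f), map_smul, RingHom.id_apply]

/-- The group elements in `H_{t,c}(G)`. -/
def grp (g : G) : RatCher t c := RingQuot.mkAlgHom ℂ (CherRel t c) (FreeAlgebra.ι ℂ (.grp g))

end RatCher

/-- The relations imposed on `H_{0,c}(G)` to obtain the restricted Cherednik algebra: elements of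
`S(V)^G_+` and of `S(V*)^G_+` become zero. An element of the symmetric algebra is represented by an
element `x` of the tensor algebra that maps to it; its image in `H_{0,c}(G)`, where vectors commute
with vectors and forms with forms, does not depend on the choice of `x`. -/
inductive RestrRel [Finite G] (c : Refl G → ℂ) : RatCher 0 c → RatCher 0 c → Prop
  | vec (x : TensorAlgebra ℂ V)
      (hx : SymmetricAlgebra.algHom ℂ V x ∈ posInvariants (natRep G)) :
      RestrRel c (TensorAlgebra.lift ℂ (RatCher.vec 0 c) x) 0
  | cov (x : TensorAlgebra ℂ (Module.Dual ℂ V))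
      (hx : SymmetricAlgebra.algHom ℂ (Module.Dual ℂ V) x ∈ posInvariants (natRep G).dual) :
      RestrRel c (TensorAlgebra.lift ℂ (RatCher.cov 0 c) x) 0

/-- The restricted Cherednik algebra `H_{0,c}(G) / ⟨S(V)^G_+, S(V*)^G_+⟩`. -/
abbrev RestrCher [Finite G] (c : Refl G → ℂ) := RingQuot (RestrRel c)

namespace RestrCher

variable [Finite G] (c : Refl G → ℂ)

/-- The image of a vector in the restricted Cherednik algebra. -/
def vec (v : V) : RestrCher c := RingQuot.mkAlgHom ℂ (RestrRel c) (RatCher.vec 0 c v)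

/-- The image of a linear form in the restricted Cherednik algebra. -/
def cov (f : Module.Dual ℂ V) : RestrCher c :=
  RingQuot.mkAlgHom ℂ (RestrRel c) (RatCher.cov 0 c f)

/-- The image of a group element in the restricted Cherednik algebra. -/
def grp (g : G) : RestrCher c := RingQuot.mkAlgHom ℂ (RestrRel c) (RatCher.grp 0 c g)

end RestrCher

end Cherednik

end

open Cherednik

noncomputable section

namespace Cherednik

open scoped Matrix

/-! ### Skew derivations of free algebras -/

section SkewDerivation

variable {X Z : Type*}

/-! The Nichols–Woronowicz algebra is the tensor algebra `T(Y)` modulo the radical of a pairing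
between `T(Y*)` and `T(Y)`. In this pairing `[r]*` acts on `T(Y)` by the braided derivation `∂_r`,
with `∂_r(xy) = x ∂_r(y) + ∂_r(x) r(y)`, and one takes constant terms. Its Gram matrix in degree `n`
is the braided factorial (`derAct_wordSum`), and the radical is the largest subspace without
constant terms that is stable under all `∂_r` (`le_rightRad`). The same holds on the dual side with
the derivations `coder` (`le_leftRad`).

On the image of `V` the derivation `∂_s` becomes `c_s` times the divided difference `p ↦ (p - s p) /
α̌_s` (`der_vecHom`); on the image of `V*` the dual derivation becomes a divided difference by
`α_s`, without a factor (`coder_covHom`). Divided differences kill invariants, so invariants without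
constant term land in the radical. Commutators are a special case, as they vanish in the symmetric
algebra. This gives the two homomorphisms, since the remaining Cherednik relations are checked on
generators.

Conversely, let a subspace without constant terms be stable under the divided differences of a
generating set of reflections. By induction on degree its elements are invariant modulo the ideal of
positive-degree invariants, and averaging over the group puts them in that ideal
(`freeToSym_mem_span_of_stable`). Hence the kernel on `S(V)` is exactly that ideal when the `s` with
`c_s ≠ 0` generate `G`, and likewise on `S(V*)` for every `c`.

For injectivity of `M_c`, the double acts on functions on `G` with values in `T(Y)` modulo the
radical (`fockRep`). Functions on `G`, rather than a single copy, keep different group elements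
apart. The restricted Cherednik algebra is spanned by normally ordered products of vectors, a group
element and forms (`mem_normalSpan`). Forms of total degree `d` kill words of length less than `d`
and send a word of length `d` to a scalar, so the components of an element of the kernel can be read
off, and shown to vanish, in order of increasing degree (`restrCherHom_injective`). -/

/-- The augmentation of a free algebra. -/
abbrev aug (X : Type*) : FreeAlgebra ℂ X →ₐ[ℂ] ℂ := FreeAlgebra.algebraMapInv

@[simp]
theorem aug_ι (x : X) : aug X (FreeAlgebra.ι ℂ x) = 0 := by
  simp [aug, FreeAlgebra.algebraMapInv]

/-- The homomorphism `x ↦ !![θ₁ x, D x; 0, θ₂ x]` which encodes a skew derivation `D`. -/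
def skewMatrix (θ₁ θ₂ : FreeAlgebra ℂ X →ₐ[ℂ] FreeAlgebra ℂ X) (d : X → ℂ) :
    FreeAlgebra ℂ X →ₐ[ℂ] Matrix (Fin 2) (Fin 2) (FreeAlgebra ℂ X) :=
  FreeAlgebra.lift ℂ fun x =>
    !![θ₁ (FreeAlgebra.ι ℂ x), algebraMap ℂ _ (d x); 0, θ₂ (FreeAlgebra.ι ℂ x)]

theorem skewMatrix_entries (θ₁ θ₂ : FreeAlgebra ℂ X →ₐ[ℂ] FreeAlgebra ℂ X) (d : X → ℂ)
    (p : FreeAlgebra ℂ X) :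
    skewMatrix θ₁ θ₂ d p 0 0 = θ₁ p ∧ skewMatrix θ₁ θ₂ d p 1 0 = 0 ∧
      skewMatrix θ₁ θ₂ d p 1 1 = θ₂ p := by
  induction p using FreeAlgebra.induction with
  | grade0 z => simp [Matrix.algebraMap_matrix_apply]
  | grade1 x => simp [skewMatrix]
  | mul p q hp hq => simp [Matrix.mul_apply, Fin.sum_univ_two, hp, hq]
  | add p q hp hq => simp [hp, hq]

/-- The linear map `D` with `D (p q) = θ₁ p * D q + D p * θ₂ q` and `D x = d x` for every
generator `x`. -/
def skewDer (θ₁ θ₂ : FreeAlgebra ℂ X →ₐ[ℂ] FreeAlgebra ℂ X) (d : X → ℂ) :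
    FreeAlgebra ℂ X →ₗ[ℂ] FreeAlgebra ℂ X where
  toFun p := skewMatrix θ₁ θ₂ d p 0 1
  map_add' p q := by simp
  map_smul' z p := by simp

variable (θ₁ θ₂ : FreeAlgebra ℂ X →ₐ[ℂ] FreeAlgebra ℂ X) (d : X → ℂ)

theorem skewDer_mul (p q : FreeAlgebra ℂ X) :
    skewDer θ₁ θ₂ d (p * q) = θ₁ p * skewDer θ₁ θ₂ d q + skewDer θ₁ θ₂ d p * θ₂ q := by
  change skewMatrix θ₁ θ₂ d (p * q) 0 1 = _
  rw [map_mul, Matrix.mul_apply, Fin.sum_univ_two, (skewMatrix_entries θ₁ θ₂ d p).1,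
    (skewMatrix_entries θ₁ θ₂ d q).2.2]
  rfl

@[simp]
theorem skewDer_algebraMap (z : ℂ) : skewDer θ₁ θ₂ d (algebraMap ℂ _ z) = 0 := by
  change skewMatrix θ₁ θ₂ d (algebraMap ℂ _ z) 0 1 = 0
  simp [Matrix.algebraMap_matrix_apply]

@[simp]
theorem skewDer_one : skewDer θ₁ θ₂ d 1 = 0 := by
  simpa using skewDer_algebraMap θ₁ θ₂ d 1

@[simp]
theorem skewDer_ι (x : X) :
    skewDer θ₁ θ₂ d (FreeAlgebra.ι ℂ x) = algebraMap ℂ _ (d x) := by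
  change skewMatrix θ₁ θ₂ d (FreeAlgebra.ι ℂ x) 0 1 = _
  simp [skewMatrix]

/-- Both sides obey the same twisted Leibniz rule, so agreement on generators suffices. The
equivariance of the braided derivations and their comparison with divided differences are instances.
-/
theorem skewDer_intertwine {θ₁ θ₂ : FreeAlgebra ℂ X →ₐ[ℂ] FreeAlgebra ℂ X} {d : X → ℂ}
    {η₁ η₂ : FreeAlgebra ℂ Z →ₐ[ℂ] FreeAlgebra ℂ Z} {e : Z → ℂ}
    (φ : FreeAlgebra ℂ X →ₐ[ℂ] FreeAlgebra ℂ Z) (k : ℂ)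
    (h₁ : ∀ p, η₁ (φ p) = φ (θ₁ p)) (h₂ : ∀ p, η₂ (φ p) = φ (θ₂ p))
    (hd : ∀ x, skewDer η₁ η₂ e (φ (FreeAlgebra.ι ℂ x)) = algebraMap ℂ _ (k * d x))
    (p : FreeAlgebra ℂ X) :
    skewDer η₁ η₂ e (φ p) = k • φ (skewDer θ₁ θ₂ d p) := by
  induction p using FreeAlgebra.induction with
  | grade0 z => simp
  | grade1 x => simp [hd, Algebra.smul_def]
  | mul p q hp hq => simp [skewDer_mul, hp, hq, h₁, h₂]
  | add p q hp hq => simp [hp, hq]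

/-! ### Filtration of the free algebra by word length. -/

/-- The span of the words of length at most `n`. -/
def filt (X : Type*) (n : ℕ) : Submodule ℂ (FreeAlgebra ℂ X) :=
  Submodule.span ℂ {p | ∃ l : List X, l.length ≤ n ∧ p = (l.map (FreeAlgebra.ι ℂ)).prod}

theorem exists_mem_filt (p : FreeAlgebra ℂ X) : ∃ n, p ∈ filt X n := by
  have mono : ∀ {m n : ℕ}, m ≤ n → filt X m ≤ filt X n := fun h =>
    Submodule.span_mono fun _ ⟨l, hl, e⟩ => ⟨l, hl.trans h, e⟩
  induction p using FreeAlgebra.induction with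
  | grade0 z =>
    refine ⟨0, ?_⟩
    rw [Algebra.algebraMap_eq_smul_one]
    exact Submodule.smul_mem _ _ (Submodule.subset_span ⟨[], by simp⟩)
  | grade1 x => exact ⟨1, Submodule.subset_span ⟨[x], by simp⟩⟩
  | mul p q hp hq =>
    obtain ⟨m, hm⟩ := hp
    obtain ⟨n, hn⟩ := hq
    refine ⟨m + n, ?_⟩
    have h := Submodule.mul_mem_mul hm hn
    rw [filt, filt, Submodule.span_mul_span] at h
    refine Submodule.span_mono ?_ h
    rintro _ ⟨_, ⟨l, hl, rfl⟩, _, ⟨l', hl', rfl⟩, rfl⟩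
    exact ⟨l ++ l', by simp; omega, by simp⟩
  | add p q hp hq =>
    obtain ⟨m, hm⟩ := hp
    obtain ⟨n, hn⟩ := hq
    exact ⟨max m n, add_mem (mono (le_max_left _ _) hm) (mono (le_max_right _ _) hn)⟩

theorem span_words :
    Submodule.span ℂ (Set.range fun l : List X => (l.map (FreeAlgebra.ι ℂ)).prod) = ⊤ := by
  refine eq_top_iff.2 fun p _ => ?_
  obtain ⟨n, hn⟩ := exists_mem_filt p
  refine Submodule.span_mono ?_ hn
  rintro _ ⟨l, _, rfl⟩
  exact ⟨l, rfl⟩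

theorem eq_algebraMap_of_mem_filt_zero {p : FreeAlgebra ℂ X} (hp : p ∈ filt X 0) :
    p = algebraMap ℂ _ (aug X p) := by
  induction hp using Submodule.span_induction with
  | mem _ h =>
    obtain ⟨l, hl, rfl⟩ := h
    obtain rfl : l = [] := List.length_eq_zero_iff.1 (Nat.le_zero.1 hl)
    simp
  | zero => simp
  | add _ _ _ _ hx hy => rw [map_add, map_add, ← hx, ← hy]
  | smul z _ _ hx => rw [map_smul, smul_eq_mul, map_mul, ← hx, Algebra.smul_def]

theorem ι_mul_mem_filt {n : ℕ} {p : FreeAlgebra ℂ X} (hp : p ∈ filt X n) (x : X) :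
    FreeAlgebra.ι ℂ x * p ∈ filt X (n + 1) := by
  induction hp using Submodule.span_induction with
  | mem _ h =>
    obtain ⟨l, hl, rfl⟩ := h
    exact Submodule.subset_span ⟨x :: l, by simpa using hl, by simp⟩
  | zero => simp
  | add _ _ _ _ hx hy => rw [mul_add]; exact add_mem hx hy
  | smul z _ _ hx => rw [mul_smul_comm]; exact Submodule.smul_mem _ _ hx

theorem word_mem_filt_of_map {θ : FreeAlgebra ℂ X →ₐ[ℂ] FreeAlgebra ℂ X} {τ : X → X}
    (hθ : ∀ x, θ (FreeAlgebra.ι ℂ x) = FreeAlgebra.ι ℂ (τ x)) (l : List X) :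
    θ (l.map (FreeAlgebra.ι ℂ)).prod ∈ filt X l.length := by
  refine Submodule.subset_span ⟨l.map τ, by simp, ?_⟩
  rw [map_list_prod, List.map_map, List.map_map]
  congr 2
  funext x
  exact hθ x

/-- Skew derivations whose twists permute the generators lower the length of words. -/
theorem skewDer_mem_filt {τ₁ τ₂ : X → X}
    (h₁ : ∀ x, θ₁ (FreeAlgebra.ι ℂ x) = FreeAlgebra.ι ℂ (τ₁ x))
    (h₂ : ∀ x, θ₂ (FreeAlgebra.ι ℂ x) = FreeAlgebra.ι ℂ (τ₂ x)) {n : ℕ} {p : FreeAlgebra ℂ X}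
    (hp : p ∈ filt X (n + 1)) : skewDer θ₁ θ₂ d p ∈ filt X n := by
  have key : ∀ (n : ℕ) (l : List X), l.length ≤ n + 1 →
      skewDer θ₁ θ₂ d (l.map (FreeAlgebra.ι ℂ)).prod ∈ filt X n := by
    intro n l
    induction l generalizing n with
    | nil => intro; simp
    | cons x l ih =>
      intro hl
      rw [List.map_cons, List.prod_cons, skewDer_mul, h₁, skewDer_ι, ← Algebra.smul_def]
      refine add_mem ?_ (Submodule.smul_mem _ _ (Submodule.span_mono ?_
        (word_mem_filt_of_map h₂ l)))
      -- For `n = 0` the remaining word is empty and its derivative is zero, so no word of negative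
      -- length is needed.
      · cases n with
        | zero =>
          obtain rfl : l = [] := by simpa using hl
          simp
        | succ n => exact ι_mul_mem_filt (ih n (by simpa using hl)) _
      · rintro _ ⟨l', hl', rfl⟩
        exact ⟨l', hl'.trans (by simpa using hl), rfl⟩
  induction hp using Submodule.span_induction with
  | mem _ h =>
    obtain ⟨l, hl, rfl⟩ := h
    exact key n l hl
  | zero => simp
  | add _ _ _ _ hx hy => rw [map_add]; exact add_mem hx hy
  | smul z _ _ hx => rw [map_smul]; exact Submodule.smul_mem _ _ hx

end SkewDerivation

/-! ### Symmetric algebras and coinvariants -/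

section Symmetric

variable {U : Type*} [AddCommGroup U] [Module ℂ U]

/-- The homomorphism from the free algebra on the set `U` to the tensor algebra of `U`. -/
def freeToTensor (U : Type*) [AddCommGroup U] [Module ℂ U] :
    FreeAlgebra ℂ U →ₐ[ℂ] TensorAlgebra ℂ U :=
  FreeAlgebra.lift ℂ (TensorAlgebra.ι ℂ)

theorem freeToTensor_surjective : Function.Surjective (freeToTensor U) := fun x => by
  induction x using TensorAlgebra.induction with
  | algebraMap r => exact ⟨algebraMap ℂ _ r, by simp⟩
  | ι u => exact ⟨FreeAlgebra.ι ℂ u, by simp [freeToTensor]⟩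
  | mul a b ha hb =>
    obtain ⟨a, rfl⟩ := ha
    obtain ⟨b, rfl⟩ := hb
    exact ⟨a * b, by simp⟩
  | add a b ha hb =>
    obtain ⟨a, rfl⟩ := ha
    obtain ⟨b, rfl⟩ := hb
    exact ⟨a + b, by simp⟩

theorem tensorLift_freeToTensor {A : Type*} [Ring A] [Algebra ℂ A] (f : U →ₗ[ℂ] A)
    (p : FreeAlgebra ℂ U) :
    TensorAlgebra.lift ℂ f (freeToTensor U p) = FreeAlgebra.lift ℂ f p := by
  have : (TensorAlgebra.lift ℂ f).comp (freeToTensor U) = FreeAlgebra.lift ℂ f :=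
    FreeAlgebra.hom_ext (by ext u; simp [freeToTensor])
  exact DFunLike.congr_fun this p

/-- The homomorphism from the free algebra on the set `U` to the symmetric algebra of `U`. -/
def freeToSym (U : Type*) [AddCommGroup U] [Module ℂ U] :
    FreeAlgebra ℂ U →ₐ[ℂ] SymmetricAlgebra ℂ U :=
  FreeAlgebra.lift ℂ (SymmetricAlgebra.ι ℂ U)

@[simp]
theorem freeToSym_ι (u : U) : freeToSym U (FreeAlgebra.ι ℂ u) = SymmetricAlgebra.ι ℂ U u := by
  simp [freeToSym]

theorem algHom_freeToTensor (p : FreeAlgebra ℂ U) :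
    SymmetricAlgebra.algHom ℂ U (freeToTensor U p) = freeToSym U p := by
  have : (SymmetricAlgebra.algHom ℂ U).comp (freeToTensor U) = freeToSym U :=
    FreeAlgebra.hom_ext (by ext u; simp [freeToTensor]; rfl)
  exact DFunLike.congr_fun this p

theorem freeToSym_surjective : Function.Surjective (freeToSym U) := fun x => by
  obtain ⟨t, rfl⟩ := SymmetricAlgebra.algHom_surjective ℂ U x
  obtain ⟨p, rfl⟩ := freeToTensor_surjective t
  exact ⟨p, (algHom_freeToTensor p).symm⟩

theorem algebraMapInv_freeToSym (p : FreeAlgebra ℂ U) :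
    SymmetricAlgebra.algebraMapInv (freeToSym U p) = aug U p := by
  have : (SymmetricAlgebra.algebraMapInv).comp (freeToSym U) = aug U :=
    FreeAlgebra.hom_ext (by ext u; simp [SymmetricAlgebra.algebraMapInv_ι])
  exact DFunLike.congr_fun this p

/-- The extension of a linear map with commuting values to the symmetric algebra. -/
def symLift {A : Type*} [Ring A] [Algebra ℂ A] (f : U →ₗ[ℂ] A)
    (hf : ∀ u v, f u * f v = f v * f u) : SymmetricAlgebra ℂ U →ₐ[ℂ] A :=
  RingCon.liftₐ (TensorAlgebra.symRingCon ℂ U) (TensorAlgebra.lift ℂ f)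
    (RingCon.ringConGen_le.2 fun x y h => by
      induction h with
      | mul_comm x y => simp [RingCon.ker_apply, hf])

theorem symLift_freeToSym {A : Type*} [Ring A] [Algebra ℂ A] (f : U →ₗ[ℂ] A)
    (hf : ∀ u v, f u * f v = f v * f u) (p : FreeAlgebra ℂ U) :
    symLift f hf (freeToSym U p) = FreeAlgebra.lift ℂ f p := by
  rw [← algHom_freeToTensor, ← tensorLift_freeToTensor]
  rfl

theorem ι_ne_zero {u : U} (hu : u ≠ 0) : SymmetricAlgebra.ι ℂ U u ≠ 0 := by
  intro h
  obtain ⟨f, hf⟩ : ∃ f : Module.Dual ℂ U, f u ≠ 0 := by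
    by_contra! h'
    exact hu ((Module.forall_dual_apply_eq_zero_iff ℂ u).1 h')
  apply hf
  rw [← SymmetricAlgebra.lift_ι_apply f u, h, map_zero]

variable {Γ : Type*} [Group Γ] (ρ : Representation ℂ Γ U)

@[simp]
theorem symAct_ι (g : Γ) (u : U) :
    symAct ρ g (SymmetricAlgebra.ι ℂ U u) = SymmetricAlgebra.ι ℂ U (ρ g u) := by
  simp [symAct]

theorem symAct_mul (g h : Γ) (x : SymmetricAlgebra ℂ U) :
    symAct ρ (g * h) x = symAct ρ g (symAct ρ h x) := by
  have : symAct ρ (g * h) = (symAct ρ g).comp (symAct ρ h) :=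
    SymmetricAlgebra.algHom_ext (by ext u; simp)
  exact DFunLike.congr_fun this x

theorem symAct_one (x : SymmetricAlgebra ℂ U) : symAct ρ 1 x = x := by
  have : symAct ρ 1 = AlgHom.id ℂ _ := SymmetricAlgebra.algHom_ext (by ext u; simp)
  exact DFunLike.congr_fun this x

theorem algebraMapInv_symAct (g : Γ) (x : SymmetricAlgebra ℂ U) :
    SymmetricAlgebra.algebraMapInv (symAct ρ g x) = SymmetricAlgebra.algebraMapInv x := by
  have : (SymmetricAlgebra.algebraMapInv).comp (symAct ρ g) = SymmetricAlgebra.algebraMapInv :=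
    SymmetricAlgebra.algHom_ext (by ext u; simp [SymmetricAlgebra.algebraMapInv_ι])
  exact DFunLike.congr_fun this x

theorem zero_mem_posInvariants : (0 : SymmetricAlgebra ℂ U) ∈ posInvariants ρ :=
  ⟨fun _ => map_zero _, map_zero _⟩

theorem symAct_mem_span (g : Γ) {x : SymmetricAlgebra ℂ U}
    (hx : x ∈ Ideal.span (posInvariants ρ)) : symAct ρ g x ∈ Ideal.span (posInvariants ρ) := by
  induction hx using Submodule.span_induction with
  | mem x h => rw [h.1 g]; exact Ideal.subset_span h
  | zero => simp
  | add x y _ _ hx hy => rw [map_add]; exact add_mem hx hy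
  | smul r x _ hx => rw [smul_eq_mul, map_mul]; exact Ideal.mul_mem_left _ _ hx

/-- An element without constant term which is invariant modulo the ideal of the coinvariant
algebra lies in that ideal. -/
theorem mem_span_of_sub_mem [Finite Γ] {x : SymmetricAlgebra ℂ U}
    (h0 : SymmetricAlgebra.algebraMapInv x = 0)
    (h : ∀ g, x - symAct ρ g x ∈ Ideal.span (posInvariants ρ)) :
    x ∈ Ideal.span (posInvariants ρ) := by
  have := Fintype.ofFinite Γ
  have hcard : (Fintype.card Γ : ℂ) ≠ 0 := Nat.cast_ne_zero.2 Fintype.card_ne_zero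
  -- Averaging: `|Γ| x` is the sum of all `x - g x`, which lie in the ideal, and of all `g x`, which
  -- add up to an invariant without constant term.
  have hinv : ∑ g, symAct ρ g x ∈ posInvariants ρ := by
    refine ⟨fun g => ?_, ?_⟩
    · rw [map_sum]
      simp_rw [← symAct_mul]
      exact Fintype.sum_equiv (Equiv.mulLeft g) _ _ fun _ => rfl
    · rw [map_sum]
      exact Finset.sum_eq_zero fun g _ => by rw [algebraMapInv_symAct, h0]
  have hsum : (Fintype.card Γ : ℂ) • x ∈ Ideal.span (posInvariants ρ) := by
    have e : (Fintype.card Γ : ℂ) • x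
        = ∑ g, (x - symAct ρ g x) + ∑ g, symAct ρ g x := by
      rw [Finset.sum_sub_distrib, sub_add_cancel, Finset.sum_const, Finset.card_univ,
        Nat.cast_smul_eq_nsmul]
    rw [e]
    exact add_mem (sum_mem fun g _ => h g) (Ideal.subset_span hinv)
  rw [← inv_smul_smul₀ hcard x, Algebra.smul_def]
  exact Ideal.mul_mem_left _ _ hsum

/-! ### Divided differences and the ideal of positive-degree invariants. -/

variable {S : Type*} {γ : S → Γ} {a : S → U}
  {Δ : S → FreeAlgebra ℂ U →ₗ[ℂ] FreeAlgebra ℂ U}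

/-- Let `Δ_s` lift the divided difference operators `x ↦ (x - γ_s x) / a_s`. A subspace of elements
without constant term which is stable under enough of them maps to zero in the coinvariant
algebra. -/
theorem freeToSym_mem_span_of_stable [Finite Γ]
    (hΔ : ∀ s p, SymmetricAlgebra.ι ℂ U (a s) * freeToSym U (Δ s p)
      = freeToSym U p - symAct ρ (γ s) (freeToSym U p))
    (hdeg : ∀ s n, ∀ p ∈ filt U (n + 1), Δ s p ∈ filt U n)
    (A : Set S) (hA : Subgroup.closure (γ '' A) = ⊤)
    (P : Submodule ℂ (FreeAlgebra ℂ U)) (haug : ∀ p ∈ P, aug U p = 0)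
    (hP : ∀ s ∈ A, ∀ p ∈ P, Δ s p ∈ P) {p : FreeAlgebra ℂ U} (hp : p ∈ P) :
    freeToSym U p ∈ Ideal.span (posInvariants ρ) := by
  obtain ⟨n, hn⟩ := exists_mem_filt p
  induction n generalizing p with
  | zero =>
    rw [eq_algebraMap_of_mem_filt_zero hn, haug p hp, map_zero, map_zero]
    exact zero_mem _
  | succ n ih =>
    -- It remains to see that `p` is invariant modulo the ideal. The group elements that fix it
    -- modulo the ideal form a subgroup, because the ideal is stable. For a generator `γ s`, the
    -- difference is `a s` times `Δ s p`, which has lower degree and is covered by induction.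
    refine mem_span_of_sub_mem ρ (by rw [algebraMapInv_freeToSym, haug p hp]) fun g => ?_
    have hg : g ∈ Subgroup.closure (γ '' A) := hA ▸ Subgroup.mem_top g
    induction hg using Subgroup.closure_induction with
    | mem _ h =>
      obtain ⟨s, hs, rfl⟩ := h
      rw [← hΔ]
      exact Ideal.mul_mem_left _ _ (ih (hP s hs p hp) (hdeg s n p hn))
    | one => simp [symAct_one]
    | mul g h _ _ hg hh =>
      have e : freeToSym U p - symAct ρ (g * h) (freeToSym U p)
          = (freeToSym U p - symAct ρ g (freeToSym U p))
            + symAct ρ g (freeToSym U p - symAct ρ h (freeToSym U p)) := by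
        rw [map_sub, symAct_mul]; ring
      rw [e]
      exact add_mem hg (symAct_mem_span ρ g hh)
    | inv g _ hg =>
      have e : freeToSym U p - symAct ρ g⁻¹ (freeToSym U p)
          = -symAct ρ g⁻¹ (freeToSym U p - symAct ρ g (freeToSym U p)) := by
        rw [map_sub, ← symAct_mul, inv_mul_cancel, symAct_one]; ring
      rw [e]
      exact neg_mem (symAct_mem_span ρ _ hg)

/-- The elements without constant term which are killed by all divided differences in the symmetric
algebra. -/
def divKernel (Δ : S → FreeAlgebra ℂ U →ₗ[ℂ] FreeAlgebra ℂ U) :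
    Submodule ℂ (FreeAlgebra ℂ U) where
  carrier := {p | aug U p = 0 ∧ ∀ s, freeToSym U (Δ s p) = 0}
  add_mem' := by rintro p q ⟨hp, hp'⟩ ⟨hq, hq'⟩; simp [hp, hp', hq, hq']
  zero_mem' := by simp
  smul_mem' := by rintro z p ⟨hp, hp'⟩; simp [hp, hp']

/-- For an invariant, `a s` times the divided difference is zero, and the symmetric algebra is a
domain. -/
theorem mem_divKernel
    (hΔ : ∀ s p, SymmetricAlgebra.ι ℂ U (a s) * freeToSym U (Δ s p)
      = freeToSym U p - symAct ρ (γ s) (freeToSym U p))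
    (ha : ∀ s, a s ≠ 0) {p : FreeAlgebra ℂ U} (hp : freeToSym U p ∈ posInvariants ρ) :
    p ∈ divKernel Δ := by
  refine ⟨by rw [← algebraMapInv_freeToSym]; exact hp.2, fun s => ?_⟩
  have h := hΔ s p
  rw [hp.1, sub_self] at h
  exact (mul_eq_zero.1 h).resolve_left (ι_ne_zero (ha s))

/-- The divided difference of such an element is zero in the symmetric algebra, and zero is itself
an invariant without constant term. -/
theorem divKernel_stable
    (hΔ : ∀ s p, SymmetricAlgebra.ι ℂ U (a s) * freeToSym U (Δ s p)
      = freeToSym U p - symAct ρ (γ s) (freeToSym U p))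
    (ha : ∀ s, a s ≠ 0) (s : S) {p : FreeAlgebra ℂ U} (hp : p ∈ divKernel Δ) :
    Δ s p ∈ divKernel Δ :=
  mem_divKernel ρ hΔ ha (by rw [hp.2 s]; exact zero_mem_posInvariants ρ)

/-- The action of a group element on the free algebra on a representation. -/
def freeAct (g : Γ) : FreeAlgebra ℂ U →ₐ[ℂ] FreeAlgebra ℂ U :=
  FreeAlgebra.lift ℂ fun u => FreeAlgebra.ι ℂ (ρ g u)

@[simp]
theorem freeAct_ι (g : Γ) (u : U) :
    freeAct ρ g (FreeAlgebra.ι ℂ u) = FreeAlgebra.ι ℂ (ρ g u) := by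
  simp [freeAct]

theorem freeToSym_freeAct (g : Γ) (p : FreeAlgebra ℂ U) :
    freeToSym U (freeAct ρ g p) = symAct ρ g (freeToSym U p) := by
  have : (freeToSym U).comp (freeAct ρ g) = (symAct ρ g).comp (freeToSym U) :=
    FreeAlgebra.hom_ext (by ext u; simp)
  exact DFunLike.congr_fun this p

/-- The difference of two homomorphisms satisfies the twisted Leibniz rule: `θ₁p θ₁q - θ₂p θ₂q = θ₁p
(θ₁q - θ₂q) + (θ₁p - θ₂p) θ₂q`. Skew derivations of the free algebra thereby lift divided
differences without any division. -/
theorem ι_mul_freeToSym_skewDer {θ₁ θ₂ : FreeAlgebra ℂ U →ₐ[ℂ] FreeAlgebra ℂ U} {d : U → ℂ}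
    {b : U} (h : ∀ u, d u • SymmetricAlgebra.ι ℂ U b
      = freeToSym U (θ₁ (FreeAlgebra.ι ℂ u)) - freeToSym U (θ₂ (FreeAlgebra.ι ℂ u)))
    (p : FreeAlgebra ℂ U) :
    SymmetricAlgebra.ι ℂ U b * freeToSym U (skewDer θ₁ θ₂ d p)
      = freeToSym U (θ₁ p) - freeToSym U (θ₂ p) := by
  induction p using FreeAlgebra.induction with
  | grade0 z => simp
  | grade1 u => rw [← h, skewDer_ι, AlgHom.commutes, Algebra.smul_def, mul_comm]
  | mul p q hp hq =>
    rw [skewDer_mul, map_add, map_mul, map_mul, mul_add, mul_left_comm, hq, ← mul_assoc, hp]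
    simp only [map_mul]
    ring
  | add p q hp hq => simp only [map_add, mul_add, hp, hq]; ring

end Symmetric

/-! ### Braided factorials -/

section BraidedFactorial

set_option linter.unusedSectionVars false

/-- Partial braided integers and factorials do not change when the order of all factors is
reversed. -/
theorem factorial_mul_eq_mul_factorial {A : Type*} [Ring A] {σ b b' F : ℕ → A}
    (hb₁ : b 1 = 1) (hb₁' : b' 1 = 1) (hb : ∀ m, b (m + 2) = 1 + σ m * b (m + 1))
    (hb' : ∀ m, b' (m + 2) = 1 + b' (m + 1) * σ m)
    (hF : ∀ m, F (m + 1) = F m * b (m + 1)) (hσ : ∀ m, Commute (F m) (σ m)) (m : ℕ) :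
    F m * b (m + 1) = b' (m + 1) * F m := by
  induction m with
  | zero => simp [hb₁, hb₁']
  | succ m ih =>
    calc F (m + 1) * b (m + 2) = F (m + 1) + b' (m + 1) * (F m * σ m) * b (m + 1) := by
          rw [hb, mul_add, mul_one, ← mul_assoc, hF, ← mul_assoc (b' _), ← ih]
      _ = F (m + 1) + b' (m + 1) * σ m * F (m + 1) := by
          rw [(hσ m).eq, hF]; simp only [mul_assoc]
      _ = b' (m + 2) * F (m + 1) := by rw [hb', add_mul, one_mul]

variable {ι : Type*} [Fintype ι] [DecidableEq ι]

/-- The word `u` followed by the letter `r`. -/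
abbrev snoc {n : ℕ} (u : Fin n → ι) (r : ι) : Fin (n + 1) → ι := Fin.snoc (α := fun _ => ι) u r

theorem sum_snoc {M : Type*} [AddCommMonoid M] {n : ℕ} (f : (Fin (n + 1) → ι) → M) :
    ∑ w, f w = ∑ r, ∑ u, f (snoc u r) := by
  rw [← (Fin.snocEquiv fun _ : Fin (n + 1) => ι).sum_comp, Fintype.sum_prod_type]
  rfl

/-- The coefficients of the words that end in the letter `r`. -/
def slice {n : ℕ} (a : (Fin (n + 1) → ι) → ℂ) (r : ι) : (Fin n → ι) → ℂ := fun u => a (snoc u r)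

theorem slice_ext {n : ℕ} {a b : (Fin (n + 1) → ι) → ℂ} (h : ∀ r, slice a r = slice b r) :
    a = b := by
  funext w
  rw [← Fin.snoc_init_self w]
  exact congrFun (h _) _

/-- The operator `A ⊗ id`. -/
def extendRight {n : ℕ} : Matrix (Fin n → ι) (Fin n → ι) ℂ →+*
    Matrix (Fin (n + 1) → ι) (Fin (n + 1) → ι) ℂ where
  toFun A := Matrix.of fun u w =>
    if u (Fin.last n) = w (Fin.last n) then A (Fin.init u) (Fin.init w) else 0
  map_one' := by
    ext u w
    rw [← Fin.snoc_init_self u, ← Fin.snoc_init_self w]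
    simp only [Matrix.of_apply, Fin.snoc_last, Fin.init_snoc, Matrix.one_apply, Fin.snoc_inj]
    split_ifs <;> simp_all
  map_mul' A B := by
    ext u w
    simp only [Matrix.of_apply, Matrix.mul_apply, sum_snoc, Fin.snoc_last, Fin.init_snoc, ite_mul,
      zero_mul]
    rw [Finset.sum_eq_single (u (Fin.last n)) (by intro r _ hr; simp [hr.symm]) (by simp)]
    split_ifs <;> simp_all
  map_zero' := by ext; simp
  map_add' A B := by ext u w; simp only [Matrix.of_apply, Matrix.add_apply]; split_ifs <;> simp

theorem extendRight_snoc {n : ℕ} (A : Matrix (Fin n → ι) (Fin n → ι) ℂ) (u w : Fin n → ι)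
    (r s : ι) : extendRight A (snoc u r) (snoc w s) = if r = s then A u w else 0 := by
  simp [extendRight]

theorem slice_extendRight_mulVec {n : ℕ} (A : Matrix (Fin n → ι) (Fin n → ι) ℂ)
    (a : (Fin (n + 1) → ι) → ℂ) (r : ι) : slice (extendRight A *ᵥ a) r = A *ᵥ slice a r := by
  funext u
  simp only [slice, Matrix.mulVec, dotProduct, sum_snoc, extendRight_snoc, ite_mul, zero_mul]
  rw [Finset.sum_eq_single r (by intro s _ hs; simp [hs.symm]) (by simp)]
  simp

variable (Ψ : Matrix (ι × ι) (ι × ι) ℂ)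

theorem adjLeg_succ {n i : ℕ} (h : i + 1 < n) :
    adjLeg Ψ (n + 1) i = extendRight (adjLeg Ψ n i) := by
  rw [adjLeg, adjLeg, dif_pos h, dif_pos (by omega)]
  ext u w
  obtain ⟨u, r, rfl⟩ : ∃ u' r, u = snoc u' r := ⟨_, _, (Fin.snoc_init_self u).symm⟩
  obtain ⟨w, s, rfl⟩ : ∃ w' s, w = snoc w' s := ⟨_, _, (Fin.snoc_init_self w).symm⟩
  rw [extendRight_snoc]
  have e : ∀ (j : ℕ) (hj : j < n) (v : Fin n → ι) (t : ι),
      snoc v t ⟨j, hj.trans (Nat.lt_succ_self n)⟩ = v ⟨j, hj⟩ := fun j hj v t =>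
    Fin.snoc_castSucc (α := fun _ => ι) t v ⟨j, hj⟩
  have hl : ∀ j (hj : j < n), Fin.last n ≠ ⟨j, hj.trans (Nat.lt_succ_self n)⟩ := fun j hj h' => by
    have := congrArg Fin.val h'
    simp at this
    omega
  simp only [leg, Matrix.of_apply, e _ (Nat.lt_of_succ_lt h), e _ h, Fin.forall_fin_succ',
    Fin.snoc_castSucc, Fin.snoc_last]
  have hc : ∀ (k : Fin n) (j : ℕ) (hj : j < n),
      k.castSucc ≠ ⟨j, hj.trans (Nat.lt_succ_self n)⟩ ↔ k ≠ ⟨j, hj⟩ := fun k j hj => by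
    simp [Fin.ext_iff]
  simp only [hc _ _ (Nat.lt_of_succ_lt h), hc _ _ h]
  have h1 := hl i (Nat.lt_of_succ_lt h)
  have h2 := hl (i + 1) h
  by_cases hrs : r = s <;> simp [hrs, h1, h2]

theorem adjLeg_last {n : ℕ} (u w : Fin n → ι) (k l r s : ι) :
    adjLeg Ψ (n + 2) n (snoc (snoc u k) l) (snoc (snoc w r) s)
      = if u = w then Ψ (k, l) (r, s) else 0 := by
  rw [adjLeg, dif_pos (by omega)]
  have e1 : (⟨n, by omega⟩ : Fin (n + 2)) = (Fin.last n).castSucc := rfl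
  have e2 : (⟨n + 1, by omega⟩ : Fin (n + 2)) = Fin.last (n + 1) := rfl
  simp only [leg, Matrix.of_apply, e1, e2, Fin.forall_fin_succ', Fin.snoc_castSucc, Fin.snoc_last,
    funext_iff]
  simp [Fin.castSucc_inj, Fin.castSucc_ne_last]

theorem slice_slice_adjLeg_last {n : ℕ} (a : (Fin (n + 2) → ι) → ℂ) (k l : ι) :
    slice (slice (adjLeg Ψ (n + 2) n *ᵥ a) l) k
      = ∑ r, ∑ s, Ψ (k, l) (r, s) • slice (slice a s) r := by
  funext u
  simp only [slice, Matrix.mulVec, dotProduct, sum_snoc, adjLeg_last, ite_mul, zero_mul,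
    Finset.sum_apply, Pi.smul_apply, smul_eq_mul]
  rw [Finset.sum_comm]
  simp

theorem adjLeg_commute {i j : ℕ} (hij : i + 2 ≤ j) (n : ℕ) :
    Commute (adjLeg Ψ n i) (adjLeg Ψ n j) := by
  induction n with
  | zero => simp [adjLeg]
  | succ n ih =>
    rcases lt_trichotomy (j + 1) n with h | h | h
    · rw [adjLeg_succ Ψ h, adjLeg_succ Ψ (by omega)]
      exact ih.map extendRight
    -- Here `j` is the last available position: its operator mixes only the final two letters, while
    -- the one at `i` acts identically on every slice with these two letters fixed.
    · subst h
      rw [adjLeg_succ Ψ (by omega), adjLeg_succ Ψ (by omega)]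
      refine Matrix.mulVec_injective (funext fun a => ?_)
      rw [← Matrix.mulVec_mulVec, ← Matrix.mulVec_mulVec]
      refine slice_ext fun l => slice_ext fun k => ?_
      rw [slice_extendRight_mulVec, slice_extendRight_mulVec, slice_slice_adjLeg_last,
        slice_slice_adjLeg_last]
      simp only [slice_extendRight_mulVec, Matrix.mulVec_sum, Matrix.mulVec_smul]
    · rw [adjLeg.eq_def Ψ (n + 1) j, dif_neg (by omega)]
      exact Commute.one_right _

theorem braidedInt_one (n : ℕ) : braidedInt Ψ n 1 = 1 := by simp [braidedInt]

theorem braidedInt_succ (n m : ℕ) :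
    braidedInt Ψ n (m + 2) = 1 + adjLeg Ψ n m * braidedInt Ψ n (m + 1) := by
  rw [braidedInt, Finset.sum_range_succ', add_comm, braidedInt, Finset.mul_sum]
  congr 1
  refine Finset.sum_congr rfl fun k _ => ?_
  rw [List.range_succ_eq_map, List.map_cons, List.prod_cons, List.map_map]
  congr 3
  funext j
  simp only [Function.comp_apply]
  congr 1
  omega

theorem braidedInt_extend {n m : ℕ} (h : m ≤ n) :
    braidedInt Ψ (n + 1) m = extendRight (braidedInt Ψ n m) := by
  rw [braidedInt, braidedInt, map_sum]
  refine Finset.sum_congr rfl fun k hk => ?_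
  rw [map_list_prod, List.map_map]
  congr 1
  refine List.map_congr_left fun j hj => ?_
  have hk := Finset.mem_range.1 hk
  have hj := List.mem_range.1 hj
  exact adjLeg_succ Ψ (by omega)

/-- The product `[1] [2] ⋯ [m]` acting on the first `m` tensor factors. -/
def partialFactorial (n m : ℕ) : Matrix (Fin n → ι) (Fin n → ι) ℂ :=
  ((List.range m).map fun k => braidedInt Ψ n (k + 1)).prod

theorem partialFactorial_succ (n m : ℕ) :
    partialFactorial Ψ n (m + 1) = partialFactorial Ψ n m * braidedInt Ψ n (m + 1) := by
  simp [partialFactorial, List.range_succ]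

theorem braidedFactorial_succ (n : ℕ) :
    braidedFactorial Ψ (n + 1)
      = extendRight (braidedFactorial Ψ n) * braidedInt Ψ (n + 1) (n + 1) := by
  have : extendRight (braidedFactorial Ψ n) = partialFactorial Ψ (n + 1) n := by
    rw [braidedFactorial, map_list_prod, List.map_map]
    congr 1
    exact List.map_congr_left fun k hk =>
      (braidedInt_extend Ψ (Nat.succ_le_of_lt (List.mem_range.1 hk))).symm
  rw [this, ← partialFactorial_succ]
  rfl

/-- The partial factorial involves only the positions up to `m - 2`, which are disjoint from `m` and
`m + 1`. -/
theorem partialFactorial_commute (n m : ℕ) :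
    Commute (partialFactorial Ψ n m) (adjLeg Ψ n m) := by
  refine Commute.list_prod_left _ _ fun x hx => ?_
  obtain ⟨i, hi, rfl⟩ := List.mem_map.1 hx
  refine Commute.sum_left _ _ _ fun k hk => Commute.list_prod_left _ _ fun y hy => ?_
  obtain ⟨j, hj, rfl⟩ := List.mem_map.1 hy
  have hi := List.mem_range.1 hi
  have hj := List.mem_range.1 hj
  have hk := Finset.mem_range.1 hk
  exact adjLeg_commute Ψ (by omega) n

theorem adjLeg_transpose (n i : ℕ) : adjLeg Ψᵀ n i = (adjLeg Ψ n i)ᵀ := by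
  unfold adjLeg
  split_ifs
  · ext u w
    simp only [leg, Matrix.of_apply, Matrix.transpose_apply, eq_comm]
  · simp

/-- The braided factorial of the adjoint braiding is the adjoint of the braided factorial. -/
theorem braidedFactorial_transpose (n : ℕ) :
    braidedFactorial Ψᵀ n = (braidedFactorial Ψ n)ᵀ := by
  suffices h : ∀ m, (partialFactorial Ψᵀ n m)ᵀ = partialFactorial Ψ n m by
    rw [← Matrix.transpose_transpose (braidedFactorial Ψᵀ n)]
    exact congrArg _ (h n)
  intro m
  induction m with
  | zero => simp [partialFactorial]
  | succ m ih =>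
    rw [partialFactorial_succ, Matrix.transpose_mul, ih, partialFactorial_succ]
    -- Transposition reverses all products. Undoing the reversal takes only the commutation of
    -- distant legs; the braid relation plays no role.
    refine (factorial_mul_eq_mul_factorial (σ := adjLeg Ψ n) (F := partialFactorial Ψ n)
      (b := braidedInt Ψ n) (b' := fun m => (braidedInt Ψᵀ n m)ᵀ) (braidedInt_one Ψ n)
      (by simp [braidedInt_one]) (braidedInt_succ Ψ n) (fun m => ?_) (partialFactorial_succ Ψ n)
      (partialFactorial_commute Ψ n) m).symm
    simp only [braidedInt_succ, adjLeg_transpose, Matrix.transpose_add, Matrix.transpose_one,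
      Matrix.transpose_mul, Matrix.transpose_transpose]

/-! ### Words -/

variable {A : Type*} [Ring A] [Algebra ℂ A]

theorem wordSum_zero (x : ι → A) (a : (Fin 0 → ι) → ℂ) :
    wordSum x a = algebraMap ℂ A (a Fin.elim0) := by
  rw [wordSum, Fintype.sum_unique, Algebra.algebraMap_eq_smul_one]
  simp only [List.ofFn_zero, List.prod_nil]
  congr 2

theorem wordSum_succ (x : ι → A) {n : ℕ} (a : (Fin (n + 1) → ι) → ℂ) :
    wordSum x a = ∑ s, wordSum x (slice a s) * x s := by
  simp only [wordSum, sum_snoc, Finset.sum_mul, slice, smul_mul_assoc]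
  refine Finset.sum_congr rfl fun r _ => Finset.sum_congr rfl fun u _ => ?_
  rw [List.ofFn_succ']
  simp

theorem wordSum_add (x : ι → A) {n : ℕ} (a b : (Fin n → ι) → ℂ) :
    wordSum x (a + b) = wordSum x a + wordSum x b := by
  simp [wordSum, add_smul, Finset.sum_add_distrib]

theorem wordSum_smul (x : ι → A) {n : ℕ} (z : ℂ) (a : (Fin n → ι) → ℂ) :
    wordSum x (z • a) = z • wordSum x a := by
  simp [wordSum, mul_smul, Finset.smul_sum]

/-- `wordSum` as a linear map. -/
def wordSumₗ (x : ι → A) (n : ℕ) : ((Fin n → ι) → ℂ) →ₗ[ℂ] A where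
  toFun := wordSum x
  map_add' := wordSum_add x
  map_smul' := wordSum_smul x

@[simp]
theorem wordSumₗ_apply (x : ι → A) {n : ℕ} (a : (Fin n → ι) → ℂ) :
    wordSumₗ x n a = wordSum x a := rfl

theorem wordSum_single (x : ι → A) {n : ℕ} (w : Fin n → ι) :
    wordSum x (Pi.single w 1) = (List.ofFn fun k => x (w k)).prod := by
  rw [wordSum, Finset.sum_eq_single w (by intro v _ hv; simp [hv]) (by simp)]
  simp

theorem map_wordSum {B : Type*} [Ring B] [Algebra ℂ B] (φ : A →ₐ[ℂ] B) (x : ι → A) {n : ℕ}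
    (a : (Fin n → ι) → ℂ) : φ (wordSum x a) = wordSum (fun i => φ (x i)) a := by
  simp only [wordSum, map_sum, map_smul, map_list_prod, List.map_ofFn]
  rfl

theorem iSup_range_wordSum :
    ⨆ n, LinearMap.range (wordSumₗ (FreeAlgebra.ι ℂ (X := ι)) n) = ⊤ := by
  rw [eq_top_iff, ← span_words, Submodule.span_le]
  rintro _ ⟨l, rfl⟩
  refine Submodule.mem_iSup_of_mem l.length ⟨Pi.single l.get 1, ?_⟩
  rw [wordSumₗ_apply, wordSum_single]
  congr 1
  conv_rhs => rw [← List.ofFn_get l, List.map_ofFn]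
  rfl

theorem exists_eq_sum_wordSum (x : FreeAlgebra ℂ ι) :
    ∃ (s : Finset ℕ) (a : ∀ n, (Fin n → ι) → ℂ), x = ∑ n ∈ s, wordSum (FreeAlgebra.ι ℂ) (a n) := by
  have hx : x ∈ ⨆ n, LinearMap.range (wordSumₗ (FreeAlgebra.ι ℂ (X := ι)) n) := by
    rw [iSup_range_wordSum]; trivial
  obtain ⟨f, hf, rfl⟩ := (Submodule.mem_iSup_iff_exists_finsupp _ _).1 hx
  choose a ha using hf
  exact ⟨f.support, a, Finset.sum_congr rfl fun n _ => (ha n).symm⟩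

end BraidedFactorial

section Cocycle

/-! ### The cocycle of root data -/

variable {V : Type*} [AddCommGroup V] [Module ℂ V]
  {G : Subgroup (LinearMap.GeneralLinearGroup ℂ V)}

theorem Refl.conj_mul (g h : G) (s : Refl G) : s.conj (g * h) = (s.conj h).conj g :=
  Subtype.ext (by simp [Refl.conj, mul_assoc])

theorem Refl.conj_one (s : Refl G) : s.conj 1 = s := Subtype.ext (by simp [Refl.conj])

theorem Refl.conj_injective (g : G) : Function.Injective (Refl.conj g) :=
  Function.LeftInverse.injective (g := Refl.conj g⁻¹) fun s => by
    rw [← Refl.conj_mul, inv_mul_cancel, Refl.conj_one]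

/-- Conjugation by `g` as a permutation of the reflections. -/
def Refl.conjEquiv (g : G) : Refl G ≃ Refl G where
  toFun := Refl.conj g
  invFun := Refl.conj g⁻¹
  left_inv s := by rw [← Refl.conj_mul, inv_mul_cancel, Refl.conj_one]
  right_inv s := by rw [← Refl.conj_mul, mul_inv_cancel, Refl.conj_one]

theorem Refl.conjEquiv_apply (g : G) (s : Refl G) : Refl.conjEquiv g s = s.conj g := rfl

theorem Refl.conj_val (g : G) (s : Refl G) : (s.conj g).1 = g * s.1 * g⁻¹ := rfl

namespace RootData

variable (R : RootData G)

theorem root_smul_coroot_ne_zero (s : Refl G) : ∃ v, R.root s v • R.coroot s ≠ 0 := by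
  by_contra! h
  have h0 : (1 - natRep G s.1 : V →ₗ[ℂ] V) = 0 := by
    ext v
    simp [R.apply_eq, h]
  have hs : Module.finrank ℂ (LinearMap.range (1 - natRep G s.1)) = 1 := s.2
  rw [h0, LinearMap.range_zero, finrank_bot] at hs
  exact zero_ne_one hs

theorem coroot_ne_zero (s : Refl G) : R.coroot s ≠ 0 := fun h => by
  obtain ⟨v, hv⟩ := R.root_smul_coroot_ne_zero s
  exact hv (by rw [h, smul_zero])

theorem root_ne_zero (s : Refl G) : R.root s ≠ 0 := fun h => by
  obtain ⟨v, hv⟩ := R.root_smul_coroot_ne_zero s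
  exact hv (by rw [h, LinearMap.zero_apply, zero_smul])

theorem cocycle_one (s : Refl G) : R.cocycle 1 s = 1 := by
  refine smul_left_injective ℂ (R.coroot_ne_zero (s.conj 1)) ?_
  simp only
  rw [← R.cocycle_spec, Refl.conj_one, map_one, one_smul]
  rfl

theorem cocycle_mul (g h : G) (s : Refl G) :
    R.cocycle (g * h) s = R.cocycle g (s.conj h) * R.cocycle h s := by
  refine smul_left_injective ℂ (R.coroot_ne_zero (s.conj (g * h))) ?_
  simp only
  rw [← R.cocycle_spec, map_mul, Module.End.mul_apply, R.cocycle_spec h, map_smul, R.cocycle_spec g,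
    smul_smul, Refl.conj_mul, mul_comm]

theorem cocycle_inv_mul (g : G) (s : Refl G) :
    R.cocycle g⁻¹ (s.conj g) * R.cocycle g s = 1 := by
  rw [← cocycle_mul, inv_mul_cancel, cocycle_one]

theorem cocycle_ne_zero (g : G) (s : Refl G) : R.cocycle g s ≠ 0 :=
  right_ne_zero_of_mul_eq_one (R.cocycle_inv_mul g s)

theorem root_conj (g : G) (s : Refl G) (v : V) :
    R.root (s.conj g) (natRep G g v) = R.root s v * R.cocycle g s := by
  have h1 := R.apply_eq (s.conj g) (natRep G g v)
  have h2 : natRep G (s.conj g).1 (natRep G g v) = natRep G g (natRep G s.1 v) := by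
    change (natRep G (g * s.1 * g⁻¹) * natRep G g) v = (natRep G g * natRep G s.1) v
    rw [← map_mul, ← map_mul, inv_mul_cancel_right]
  rw [h2, R.apply_eq s v, map_sub, map_smul, sub_right_inj, R.cocycle_spec, smul_smul] at h1
  exact (smul_left_injective ℂ (R.coroot_ne_zero (s.conj g)) h1).symm

theorem dual_coroot_conj (g : G) (s : Refl G) (f : Module.Dual ℂ V) :
    (natRep G).dual g f (R.coroot (s.conj g)) = (R.cocycle g s)⁻¹ * f (R.coroot s) := by
  rw [Representation.dual_apply, Module.Dual.transpose_apply, LinearMap.comp_apply,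
    R.cocycle_spec, ← Refl.conj_mul, inv_mul_cancel, Refl.conj_one, map_smul, smul_eq_mul,
    eq_inv_of_mul_eq_one_left (R.cocycle_inv_mul g s)]

/-! ### Braided derivations -/

/-- The action of `G` on the tensor algebra of `Y_G`. -/
def act (g : G) : FreeAlgebra ℂ (Refl G) →ₐ[ℂ] FreeAlgebra ℂ (Refl G) :=
  FreeAlgebra.lift ℂ fun s => R.cocycle g s • FreeAlgebra.ι ℂ (s.conj g)

/-- The action of `G` on the tensor algebra of the dual of `Y_G`. -/
def coact (g : G) : FreeAlgebra ℂ (Refl G) →ₐ[ℂ] FreeAlgebra ℂ (Refl G) :=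
  FreeAlgebra.lift ℂ fun s => (R.cocycle g s)⁻¹ • FreeAlgebra.ι ℂ (s.conj g)

@[simp]
theorem act_ι (g : G) (s : Refl G) :
    R.act g (FreeAlgebra.ι ℂ s) = R.cocycle g s • FreeAlgebra.ι ℂ (s.conj g) := by
  simp [act]

@[simp]
theorem coact_ι (g : G) (s : Refl G) :
    R.coact g (FreeAlgebra.ι ℂ s) = (R.cocycle g s)⁻¹ • FreeAlgebra.ι ℂ (s.conj g) := by
  simp [coact]

theorem act_mul (g h : G) (x : FreeAlgebra ℂ (Refl G)) :
    R.act (g * h) x = R.act g (R.act h x) := by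
  have : R.act (g * h) = (R.act g).comp (R.act h) := FreeAlgebra.hom_ext <| by
    ext s
    simp [cocycle_mul, Refl.conj_mul, smul_smul, mul_comm]
  exact DFunLike.congr_fun this x

theorem act_one (x : FreeAlgebra ℂ (Refl G)) : R.act 1 x = x := by
  have : R.act 1 = AlgHom.id ℂ _ := FreeAlgebra.hom_ext <| by
    ext s
    simp [cocycle_one, Refl.conj_one]
  exact DFunLike.congr_fun this x

theorem aug_act (g : G) (x : FreeAlgebra ℂ (Refl G)) : aug _ (R.act g x) = aug _ x := by
  have : (aug (Refl G)).comp (R.act g) = aug (Refl G) := FreeAlgebra.hom_ext <| by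
    ext s
    simp
  exact DFunLike.congr_fun this x

/-- The braided derivation `∂_r` of the tensor algebra of `Y_G`. -/
def der (r : Refl G) : FreeAlgebra ℂ (Refl G) →ₗ[ℂ] FreeAlgebra ℂ (Refl G) :=
  skewDer (AlgHom.id ℂ _) (R.act r.1) fun s => if r = s then 1 else 0

/-- The braided derivation of the tensor algebra of the dual of `Y_G`. -/
def coder (r : Refl G) : FreeAlgebra ℂ (Refl G) →ₗ[ℂ] FreeAlgebra ℂ (Refl G) :=
  skewDer (R.coact r.1⁻¹) (AlgHom.id ℂ _) fun s => if r = s then 1 else 0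

theorem der_mul (r : Refl G) (x y : FreeAlgebra ℂ (Refl G)) :
    R.der r (x * y) = x * R.der r y + R.der r x * R.act r.1 y :=
  skewDer_mul _ _ _ x y

theorem der_ι_mul (r s : Refl G) (x : FreeAlgebra ℂ (Refl G)) :
    R.der r (FreeAlgebra.ι ℂ s * x)
      = FreeAlgebra.ι ℂ s * R.der r x + if r = s then R.act r.1 x else 0 := by
  rw [der_mul, der, skewDer_ι]
  split_ifs <;> simp

theorem coder_mul (r : Refl G) (x y : FreeAlgebra ℂ (Refl G)) :
    R.coder r (x * y) = R.coact r.1⁻¹ x * R.coder r y + R.coder r x * y :=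
  skewDer_mul _ _ _ x y

/-- Equivariance of the derivations. The factor `λ(g, r)` is inverse to the one in the
contragredient action, so `derAct` is `G`-equivariant. -/
theorem der_conj (g : G) (r : Refl G) (x : FreeAlgebra ℂ (Refl G)) :
    R.der (r.conj g) (R.act g x) = R.cocycle g r • R.act g (R.der r x) := by
  refine skewDer_intertwine (θ₁ := AlgHom.id ℂ _) (θ₂ := R.act r.1)
    (d := fun s => if r = s then 1 else 0) (η₁ := AlgHom.id ℂ _) (η₂ := R.act (r.conj g).1)
    (e := fun s => if r.conj g = s then 1 else 0) (R.act g) (R.cocycle g r) (fun _ => rfl)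
    (fun p => ?_) (fun s => ?_) x
  · rw [← act_mul, ← act_mul, Refl.conj_val, inv_mul_cancel_right]
  · rw [act_ι, map_smul, skewDer_ι, Algebra.smul_def, ← map_mul]
    simp only [(Refl.conj_injective g).eq_iff]
    split_ifs with h
    · rw [h]
    · simp

/-- The action of the tensor algebra of the dual of `Y_G` by braided derivations. -/
def derAct : FreeAlgebra ℂ (Refl G) →ₐ[ℂ] Module.End ℂ (FreeAlgebra ℂ (Refl G)) :=
  FreeAlgebra.lift ℂ R.der

@[simp]
theorem derAct_ι (r : Refl G) : R.derAct (FreeAlgebra.ι ℂ r) = R.der r := by simp [derAct]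

theorem derAct_coact (g : G) (x b : FreeAlgebra ℂ (Refl G)) :
    R.derAct (R.coact g x) (R.act g b) = R.act g (R.derAct x b) := by
  induction x using FreeAlgebra.induction generalizing b with
  | grade0 z => simp [Module.algebraMap_end_apply]
  | grade1 r =>
    rw [coact_ι, map_smul, derAct_ι, derAct_ι, LinearMap.smul_apply, der_conj,
      inv_smul_smul₀ (R.cocycle_ne_zero g r)]
  | mul x y hx hy => simp only [map_mul, Module.End.mul_apply, hy, hx]
  | add x y hx hy => simp only [map_add, LinearMap.add_apply, hy, hx]

theorem derAct_act (g : G) (x b : FreeAlgebra ℂ (Refl G)) :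
    R.derAct x (R.act g b) = R.act g (R.derAct (R.coact g⁻¹ x) b) := by
  conv_rhs => rw [← R.act_one b, ← inv_mul_cancel g, act_mul, derAct_coact, ← act_mul,
    mul_inv_cancel, act_one]

theorem derAct_one (x : FreeAlgebra ℂ (Refl G)) : R.derAct x 1 = algebraMap ℂ _ (aug _ x) := by
  induction x using FreeAlgebra.induction with
  | grade0 z => simp [Algebra.algebraMap_eq_smul_one]
  | grade1 r => simp [der]
  | mul x y hx hy =>
    rw [map_mul, Module.End.mul_apply, hy, Algebra.algebraMap_eq_smul_one, map_smul, hx,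
      Algebra.smul_def, ← map_mul, map_mul (aug _), mul_comm]
  | add x y hx hy => rw [map_add, LinearMap.add_apply, hx, hy, map_add, map_add]

/-- The Heisenberg relation for a general `x`. Moving the twist by `s` to the left past the
remaining derivations costs the action of `s⁻¹` on them, which is the twist in `coder`. -/
theorem derAct_ι_mul (x b : FreeAlgebra ℂ (Refl G)) (s : Refl G) :
    R.derAct x (FreeAlgebra.ι ℂ s * b)
      = FreeAlgebra.ι ℂ s * R.derAct x b + R.act s.1 (R.derAct (R.coder s x) b) := by
  induction x using FreeAlgebra.induction generalizing b with
  | grade0 z => simp [Module.algebraMap_end_apply, coder]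
  | grade1 r =>
    rw [derAct_ι, der_ι_mul, coder, skewDer_ι]
    by_cases h : r = s
    · simp [h]
    · simp [h, Ne.symm h]
  | mul x y hx hy =>
    rw [map_mul R.derAct, Module.End.mul_apply, Module.End.mul_apply, hy, map_add, hx, coder_mul,
      derAct_act, map_add R.derAct, map_mul R.derAct, map_mul R.derAct, LinearMap.add_apply,
      map_add (R.act _), add_assoc, add_comm (R.act _ _)]
    rfl
  | add x y hx hy =>
    simp only [map_add, LinearMap.add_apply, hx, hy, mul_add]
    abel

/-! ### The pairing and its radicals. -/

/-- The pairing between the tensor algebras of the dual of `Y_G` and of `Y_G`. -/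
def pair (x b : FreeAlgebra ℂ (Refl G)) : ℂ := aug _ (R.derAct x b)

/-- The ideal of relations of the Nichols algebra: the right radical of the pairing. -/
def rightRad : Submodule ℂ (FreeAlgebra ℂ (Refl G)) where
  carrier := {b | ∀ x, R.pair x b = 0}
  add_mem' hb hb' x := by
    have h := hb x
    have h' := hb' x
    rw [pair] at h h' ⊢
    rw [map_add, map_add, h, h', add_zero]
  zero_mem' x := by simp [pair]
  smul_mem' z b hb x := by
    have h := hb x
    rw [pair] at h ⊢
    rw [map_smul, map_smul, h, smul_zero]

/-- The left radical of the pairing. -/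
def leftRad : Submodule ℂ (FreeAlgebra ℂ (Refl G)) where
  carrier := {x | ∀ b, R.pair x b = 0}
  add_mem' hb hb' x := by
    have h := hb x
    have h' := hb' x
    rw [pair] at h h' ⊢
    rw [map_add, LinearMap.add_apply, map_add, h, h', add_zero]
  zero_mem' x := by simp [pair]
  smul_mem' z b hb x := by
    have h := hb x
    rw [pair] at h ⊢
    rw [map_smul, LinearMap.smul_apply, map_smul, h, smul_zero]

theorem aug_of_mem_rightRad {b : FreeAlgebra ℂ (Refl G)} (hb : b ∈ R.rightRad) : aug _ b = 0 := by
  simpa [pair] using hb 1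

/-- The derivation `∂_r` is adjoint to right multiplication by `[r]*`. -/
theorem der_mem_rightRad {b : FreeAlgebra ℂ (Refl G)} (hb : b ∈ R.rightRad) (r : Refl G) :
    R.der r b ∈ R.rightRad := fun x => by
  simpa [pair] using hb (x * FreeAlgebra.ι ℂ r)

/-- Every subspace of the augmentation ideal which is stable under the braided derivations is
contained in the radical. -/
theorem le_rightRad {P : Submodule ℂ (FreeAlgebra ℂ (Refl G))} (haug : ∀ b ∈ P, aug _ b = 0)
    (hder : ∀ r, ∀ b ∈ P, R.der r b ∈ P) : P ≤ R.rightRad := fun b hb x => by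
  refine haug _ ?_
  induction x using FreeAlgebra.induction generalizing b with
  | grade0 z => rw [AlgHom.commutes]; exact P.smul_mem z hb
  | grade1 r => rw [derAct_ι]; exact hder r b hb
  | mul x y hx hy => rw [map_mul]; exact hx _ (hy _ hb)
  | add x y hx hy => rw [map_add]; exact add_mem (hx _ hb) (hy _ hb)

theorem act_mem_rightRad (g : G) {b : FreeAlgebra ℂ (Refl G)} (hb : b ∈ R.rightRad) :
    R.act g b ∈ R.rightRad := fun x => by
  rw [pair, derAct_act, aug_act]
  exact hb _

theorem mul_mem_rightRad {b : FreeAlgebra ℂ (Refl G)} (hb : b ∈ R.rightRad)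
    (x y : FreeAlgebra ℂ (Refl G)) : x * b * y ∈ R.rightRad := by
  -- The two-sided ideal generated by the radical has no constant terms and, by the Leibniz rule and
  -- `G`-stability, is stable under the derivations. By maximality it is the radical.
  let P : Submodule ℂ (FreeAlgebra ℂ (Refl G)) :=
    Submodule.span ℂ {z | ∃ b ∈ R.rightRad, ∃ x y, z = x * b * y}
  refine R.le_rightRad (P := P) ?_ ?_ (Submodule.subset_span ⟨b, hb, x, y, rfl⟩)
  · intro z hz
    induction hz using Submodule.span_induction with
    | mem _ h =>
      obtain ⟨b, hb, x, y, rfl⟩ := h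
      simp [R.aug_of_mem_rightRad hb]
    | zero => simp
    | add _ _ _ _ hx hy => rw [map_add, hx, hy, add_zero]
    | smul z _ _ hx => rw [map_smul, hx, smul_zero]
  · intro r z hz
    induction hz using Submodule.span_induction with
    | mem _ h =>
      obtain ⟨b, hb, x, y, rfl⟩ := h
      rw [der_mul, der_mul, add_mul]
      exact add_mem (Submodule.subset_span ⟨b, hb, x, _, rfl⟩)
        (add_mem (Submodule.subset_span ⟨_, R.der_mem_rightRad hb r, x, _, rfl⟩)
          (Submodule.subset_span ⟨_, R.act_mem_rightRad r.1 hb, _, _, rfl⟩))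
    | zero => simp
    | add _ _ _ _ hx hy => rw [map_add]; exact add_mem hx hy
    | smul z _ _ hx => rw [map_smul]; exact P.smul_mem _ hx

/-- The first term of `derAct_ι_mul` has no constant term, and the action of `s` preserves constant
terms; so `coder s` is adjoint to left multiplication by `[s]`. -/
theorem pair_ι_mul (x b : FreeAlgebra ℂ (Refl G)) (s : Refl G) :
    R.pair x (FreeAlgebra.ι ℂ s * b) = R.pair (R.coder s x) b := by
  simp [pair, derAct_ι_mul, aug_act]

theorem aug_of_mem_leftRad {x : FreeAlgebra ℂ (Refl G)} (hx : x ∈ R.leftRad) : aug _ x = 0 := by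
  simpa [pair, derAct_one] using hx 1

theorem coder_mem_leftRad {x : FreeAlgebra ℂ (Refl G)} (hx : x ∈ R.leftRad) (s : Refl G) :
    R.coder s x ∈ R.leftRad := fun b => by
  rw [← pair_ι_mul]
  exact hx _

/-- Induction on the word acted upon, peeling off its first letter. The conclusion is stronger than
vanishing of the pairing: such elements act by zero on the whole tensor algebra. -/
theorem derAct_eq_zero_of_stable {P : Submodule ℂ (FreeAlgebra ℂ (Refl G))}
    (haug : ∀ x ∈ P, aug _ x = 0) (hder : ∀ s, ∀ x ∈ P, R.coder s x ∈ P)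
    {x : FreeAlgebra ℂ (Refl G)} (hx : x ∈ P) : R.derAct x = 0 := by
  refine LinearMap.ext_on_range (v := fun l : List (Refl G) => (l.map (FreeAlgebra.ι ℂ)).prod)
    span_words fun l => ?_
  induction l generalizing x with
  | nil => simp [derAct_one, haug x hx]
  | cons s l ih =>
    have h1 := ih hx
    have h2 := ih (hder s x hx)
    simp only [LinearMap.zero_apply] at h1 h2
    simp [derAct_ι_mul, h1, h2]

theorem derAct_of_mem_leftRad {x : FreeAlgebra ℂ (Refl G)} (hx : x ∈ R.leftRad) :
    R.derAct x = 0 :=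
  R.derAct_eq_zero_of_stable (fun _ => R.aug_of_mem_leftRad)
    (fun s _ h => R.coder_mem_leftRad h s) hx

/-- Every subspace of the augmentation ideal which is stable under the dual braided derivations is
contained in the radical. -/
theorem le_leftRad {P : Submodule ℂ (FreeAlgebra ℂ (Refl G))} (haug : ∀ x ∈ P, aug _ x = 0)
    (hder : ∀ s, ∀ x ∈ P, R.coder s x ∈ P) : P ≤ R.leftRad := fun x hx b => by
  rw [pair, R.derAct_eq_zero_of_stable haug hder hx, LinearMap.zero_apply, map_zero]

end RootData

end Cocycle

section Grading

variable {V : Type*} [AddCommGroup V] [Module ℂ V]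
  {G : Subgroup (LinearMap.GeneralLinearGroup ℂ V)}

namespace RootData

variable (R : RootData G)

/-! ### The pairing and braided factorials -/

section Pairing

set_option linter.unusedSectionVars false

variable [Finite G]

/-- Peeling off the last letter gives the same recursion as `braidedInt_succ`: the term with `r = s`
is the identity summand, the other one is a braiding at the last two positions. -/
theorem der_mul_ι (r s : Refl G) (x : FreeAlgebra ℂ (Refl G)) :
    R.der r (x * FreeAlgebra.ι ℂ s)
      = (if r = s then x else 0)
        + R.cocycle r.1 s • (R.der r x * FreeAlgebra.ι ℂ (s.conj r.1)) := by
  rw [der_mul, act_ι, mul_smul_comm, der, skewDer_ι]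
  split_ifs <;> simp

/-- The braiding is monomial: an ending `[r s r⁻¹] ⊗ [r]` can only come from `[r] ⊗ [s]`. -/
theorem slice_slice_braiding {n : ℕ} (a : (Fin (n + 2) → Refl G) → ℂ) (r s : Refl G) :
    slice (slice (adjLeg R.braiding (n + 2) n *ᵥ a) r) (s.conj r.1)
      = R.cocycle r.1 s • slice (slice a s) r := by
  rw [slice_slice_adjLeg_last, Finset.sum_eq_single r, Finset.sum_eq_single s]
  · simp [braiding]
  · intro t _ ht
    simp [braiding, (Refl.conj_injective r.1).eq_iff, Ne.symm ht]
  · simp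
  · intro t _ ht
    simp [braiding, Ne.symm ht]
  · simp

/-- The braided derivations are the components of the braided integer. -/
theorem der_wordSum {n : ℕ} (a : (Fin (n + 1) → Refl G) → ℂ) (r : Refl G) :
    R.der r (wordSum (FreeAlgebra.ι ℂ) a)
      = wordSum (FreeAlgebra.ι ℂ) (slice (braidedInt R.braiding (n + 1) (n + 1) *ᵥ a) r) := by
  induction n with
  | zero =>
    rw [wordSum_succ, map_sum, braidedInt_one, Matrix.one_mulVec]
    simp only [der_mul_ι, wordSum_zero]
    simp [der]
  | succ n ih =>
    have h : ∀ s, slice (slice (adjLeg R.braiding (n + 2) n *ᵥ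
        (braidedInt R.braiding (n + 2) (n + 1) *ᵥ a)) r) (s.conj r.1)
        = R.cocycle r.1 s • slice (braidedInt R.braiding (n + 1) (n + 1) *ᵥ slice a s) r := by
      intro s
      rw [slice_slice_braiding, braidedInt_extend _ le_rfl, slice_extendRight_mulVec]
    rw [wordSum_succ, map_sum, braidedInt_succ, Matrix.add_mulVec, Matrix.one_mulVec,
      ← Matrix.mulVec_mulVec]
    simp only [der_mul_ι, ih, Finset.sum_add_distrib]
    have e : ∀ b b' : (Fin (n + 2) → Refl G) → ℂ, slice (b + b') r = slice b r + slice b' r :=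
      fun _ _ => rfl
    rw [e, wordSum_add]
    congr 1
    · simp
    · rw [wordSum_succ]
      refine Fintype.sum_equiv (Refl.conjEquiv r.1) _ _ fun s => ?_
      rw [Refl.conjEquiv_apply, h, wordSum_smul, smul_mul_assoc]

theorem derAct_wordSum_succ {n : ℕ} (a : (Fin (n + 1) → Refl G) → ℂ)
    (b : FreeAlgebra ℂ (Refl G)) :
    R.derAct (wordSum (FreeAlgebra.ι ℂ) a) b
      = ∑ r, R.derAct (wordSum (FreeAlgebra.ι ℂ) (slice a r)) (R.der r b) := by
  rw [wordSum_succ, map_sum, LinearMap.sum_apply]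
  simp only [map_mul, derAct_ι, Module.End.mul_apply]

/-- Each derivation contributes one braided integer by `der_wordSum`, and their product is the
braided factorial. Therefore the radicals are exactly the Nichols relations of `Ψ` and of its
transpose. -/
theorem derAct_wordSum {n : ℕ} (a b : (Fin n → Refl G) → ℂ) :
    R.derAct (wordSum (FreeAlgebra.ι ℂ) a) (wordSum (FreeAlgebra.ι ℂ) b)
      = algebraMap ℂ _ (a ⬝ᵥ braidedFactorial R.braiding n *ᵥ b) := by
  induction n with
  | zero =>
    rw [wordSum_zero, wordSum_zero, AlgHom.commutes, Module.algebraMap_end_apply,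
      Algebra.smul_def, ← map_mul]
    simp [braidedFactorial, dotProduct]
    rfl
  | succ n ih =>
    rw [derAct_wordSum_succ, braidedFactorial_succ, ← Matrix.mulVec_mulVec]
    simp only [der_wordSum, ih, ← slice_extendRight_mulVec]
    rw [← map_sum]
    congr 1
    simp only [dotProduct]
    rw [sum_snoc]
    rfl

theorem derAct_wordSum_of_lt {n m : ℕ} (h : m < n) (a : (Fin n → Refl G) → ℂ)
    (b : (Fin m → Refl G) → ℂ) :
    R.derAct (wordSum (FreeAlgebra.ι ℂ) a) (wordSum (FreeAlgebra.ι ℂ) b) = 0 := by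
  induction n generalizing m with
  | zero => omega
  | succ n ih =>
    rw [derAct_wordSum_succ]
    refine Finset.sum_eq_zero fun r _ => ?_
    cases m with
    | zero => rw [wordSum_zero, der, skewDer_algebraMap, map_zero]
    | succ m => rw [der_wordSum, ih (by omega)]

theorem pair_wordSum {n : ℕ} (a b : (Fin n → Refl G) → ℂ) :
    R.pair (wordSum (FreeAlgebra.ι ℂ) a) (wordSum (FreeAlgebra.ι ℂ) b)
      = a ⬝ᵥ braidedFactorial R.braiding n *ᵥ b := by
  rw [pair, derAct_wordSum, AlgHom.commutes, Algebra.algebraMap_self_apply]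

theorem pair_wordSum_of_ne {n m : ℕ} (h : n ≠ m) (a : (Fin n → Refl G) → ℂ)
    (b : (Fin m → Refl G) → ℂ) :
    R.pair (wordSum (FreeAlgebra.ι ℂ) a) (wordSum (FreeAlgebra.ι ℂ) b) = 0 := by
  induction n generalizing m with
  | zero =>
    obtain ⟨m, rfl⟩ := Nat.exists_eq_succ_of_ne_zero h.symm
    rw [pair, wordSum_zero, AlgHom.commutes, Module.algebraMap_end_apply, wordSum_succ]
    simp
  | succ n ih =>
    rw [pair, derAct_wordSum_succ, map_sum]
    refine Finset.sum_eq_zero fun r _ => ?_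
    cases m with
    | zero => rw [wordSum_zero, der, skewDer_algebraMap, map_zero, map_zero]
    | succ m => rw [der_wordSum]; exact ih (by omega) _ _

theorem pair_sum_left {κ : Type*} (s : Finset κ) (f : κ → FreeAlgebra ℂ (Refl G))
    (b : FreeAlgebra ℂ (Refl G)) : R.pair (∑ i ∈ s, f i) b = ∑ i ∈ s, R.pair (f i) b := by
  simp [pair, LinearMap.sum_apply]

theorem pair_sum_right {κ : Type*} (s : Finset κ) (f : κ → FreeAlgebra ℂ (Refl G))
    (x : FreeAlgebra ℂ (Refl G)) : R.pair x (∑ i ∈ s, f i) = ∑ i ∈ s, R.pair x (f i) := by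
  simp [pair]

theorem wordSum_mem_rightRad {n : ℕ} {a : (Fin n → Refl G) → ℂ}
    (h : braidedFactorial R.braiding n *ᵥ a = 0) :
    wordSum (FreeAlgebra.ι ℂ) a ∈ R.rightRad := fun x => by
  obtain ⟨s, b, rfl⟩ := exists_eq_sum_wordSum x
  rw [pair_sum_left]
  refine Finset.sum_eq_zero fun m _ => ?_
  rcases eq_or_ne m n with rfl | hm
  · rw [pair_wordSum, h, dotProduct_zero]
  · exact R.pair_wordSum_of_ne hm _ _

theorem wordSum_mem_leftRad {n : ℕ} {a : (Fin n → Refl G) → ℂ}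
    (h : braidedFactorial R.braidingᵀ n *ᵥ a = 0) :
    wordSum (FreeAlgebra.ι ℂ) a ∈ R.leftRad := fun x => by
  obtain ⟨s, b, rfl⟩ := exists_eq_sum_wordSum x
  rw [pair_sum_right]
  refine Finset.sum_eq_zero fun m _ => ?_
  rcases eq_or_ne n m with rfl | hm
  · rw [braidedFactorial_transpose, Matrix.mulVec_transpose] at h
    rw [pair_wordSum, Matrix.dotProduct_mulVec, h, zero_dotProduct]
  · exact R.pair_wordSum_of_ne hm _ _

/-- The radical is spanned by the relations of the Nichols algebra. -/
theorem map_eq_zero_of_mem_rightRad {A : Type*} [Ring A] [Algebra ℂ A]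
    (φ : FreeAlgebra ℂ (Refl G) →ₐ[ℂ] A)
    (hφ : ∀ (n : ℕ) (a : (Fin n → Refl G) → ℂ), braidedFactorial R.braiding n *ᵥ a = 0 →
      φ (wordSum (FreeAlgebra.ι ℂ) a) = 0)
    {b : FreeAlgebra ℂ (Refl G)} (hb : b ∈ R.rightRad) : φ b = 0 := by
  obtain ⟨s, a, rfl⟩ := exists_eq_sum_wordSum b
  rw [map_sum]
  -- Different degrees are orthogonal, so testing against words of length `n` isolates the degree
  -- `n` part. Nondegeneracy of the dot product then puts its coefficients in the kernel of the
  -- braided factorial.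
  refine Finset.sum_eq_zero fun n hn => hφ n _ (dotProduct_eq_zero_iff.1 fun w => ?_)
  have h := hb (wordSum (FreeAlgebra.ι ℂ) w)
  rwa [pair_sum_right, Finset.sum_eq_single n
    (fun m _ hm => R.pair_wordSum_of_ne hm.symm _ _) (fun h => absurd hn h), pair_wordSum,
    dotProduct_comm] at h

theorem map_eq_zero_of_mem_leftRad {A : Type*} [Ring A] [Algebra ℂ A]
    (φ : FreeAlgebra ℂ (Refl G) →ₐ[ℂ] A)
    (hφ : ∀ (n : ℕ) (a : (Fin n → Refl G) → ℂ), braidedFactorial R.braidingᵀ n *ᵥ a = 0 →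
      φ (wordSum (FreeAlgebra.ι ℂ) a) = 0)
    {x : FreeAlgebra ℂ (Refl G)} (hx : x ∈ R.leftRad) : φ x = 0 := by
  obtain ⟨s, a, rfl⟩ := exists_eq_sum_wordSum x
  rw [map_sum]
  refine Finset.sum_eq_zero fun n hn => hφ n _ ?_
  rw [braidedFactorial_transpose, Matrix.mulVec_transpose]
  refine dotProduct_eq_zero_iff.1 fun w => ?_
  have h := hx (wordSum (FreeAlgebra.ι ℂ) w)
  rwa [pair_sum_left, Finset.sum_eq_single n
    (fun m _ hm => R.pair_wordSum_of_ne hm _ _) (fun h => absurd hn h), pair_wordSum,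
    Matrix.dotProduct_mulVec] at h

end Pairing

/-! ### The grading by the group -/

/-- The product in `G` of the letters of a word. -/
def wordProd {n : ℕ} (w : Fin n → Refl G) : G := (List.ofFn fun k => (w k).1).prod

/-- The span of the words whose letters have product `g`. -/
def component (g : G) : Submodule ℂ (FreeAlgebra ℂ (Refl G)) :=
  Submodule.span ℂ {p | ∃ l : List (Refl G),
    (l.map fun s => s.1).prod = g ∧ p = (l.map (FreeAlgebra.ι ℂ)).prod}

theorem ι_mul_mem_component (s : Refl G) {g : G} {p : FreeAlgebra ℂ (Refl G)}
    (hp : p ∈ component g) : FreeAlgebra.ι ℂ s * p ∈ component (s.1 * g) := by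
  induction hp using Submodule.span_induction with
  | mem _ h =>
    obtain ⟨l, rfl, rfl⟩ := h
    exact Submodule.subset_span ⟨s :: l, by simp, by simp⟩
  | zero => simp
  | add _ _ _ _ hx hy => rw [mul_add]; exact add_mem hx hy
  | smul z _ _ hx => rw [mul_smul_comm]; exact Submodule.smul_mem _ _ hx

theorem act_word_mem_component (g : G) (l : List (Refl G)) :
    R.act g (l.map (FreeAlgebra.ι ℂ)).prod
      ∈ component (g * (l.map fun s => s.1).prod * g⁻¹) := by
  induction l with
  | nil => exact Submodule.subset_span ⟨[], by simp, by simp⟩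
  | cons s l ih =>
    simp only [List.map_cons, List.prod_cons]
    rw [map_mul, act_ι, smul_mul_assoc]
    refine Submodule.smul_mem _ _ ?_
    have h := ι_mul_mem_component (s.conj g) ih
    convert h using 2
    simp [Refl.conj_val, mul_assoc]

/-- When `∂_r` removes a letter `r`, the action of `r` conjugates the degree `h` of the letters
behind it, and `r h r⁻¹` is the former degree `r h` times `r⁻¹`. -/
theorem der_word_mem_component (r : Refl G) (l : List (Refl G)) :
    R.der r (l.map (FreeAlgebra.ι ℂ)).prod ∈ component ((l.map fun s => s.1).prod * r.1⁻¹) := by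
  induction l with
  | nil => simp [der]
  | cons s l ih =>
    simp only [List.map_cons, List.prod_cons]
    rw [der_ι_mul]
    refine add_mem ?_ ?_
    · have h := ι_mul_mem_component s ih
      convert h using 2
      simp [mul_assoc]
    · split_ifs with h
      · subst h
        simpa using R.act_word_mem_component r.1 l
      · exact zero_mem _

theorem der_mem_component (r : Refl G) {g : G} {p : FreeAlgebra ℂ (Refl G)}
    (hp : p ∈ component g) : R.der r p ∈ component (g * r.1⁻¹) := by
  induction hp using Submodule.span_induction with
  | mem _ h =>
    obtain ⟨l, rfl, rfl⟩ := h
    exact R.der_word_mem_component r l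
  | zero => simp
  | add _ _ _ _ hx hy => rw [map_add]; exact add_mem hx hy
  | smul z _ _ hx => rw [map_smul]; exact Submodule.smul_mem _ _ hx

theorem derAct_word_mem_component (l : List (Refl G)) {g : G} {p : FreeAlgebra ℂ (Refl G)}
    (hp : p ∈ component g) :
    R.derAct (l.map (FreeAlgebra.ι ℂ)).prod p ∈ component (g * (l.map fun s => s.1).prod⁻¹) := by
  induction l with
  | nil => simpa using hp
  | cons s l ih =>
    simp only [List.map_cons, List.prod_cons]
    rw [map_mul, Module.End.mul_apply, derAct_ι]
    have h := R.der_mem_component s ih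
    convert h using 2
    simp [mul_assoc]

theorem aug_of_mem_component {g : G} (hg : g ≠ 1) {p : FreeAlgebra ℂ (Refl G)}
    (hp : p ∈ component g) : aug _ p = 0 := by
  induction hp using Submodule.span_induction with
  | mem _ h =>
    obtain ⟨l, rfl, rfl⟩ := h
    cases l with
    | nil => simp at hg
    | cons s l => simp
  | zero => simp
  | add _ _ _ _ hx hy => rw [map_add, hx, hy, add_zero]
  | smul z _ _ hx => rw [map_smul, hx, smul_zero]

theorem prod_ofFn_ι {n : ℕ} (w : Fin n → Refl G) :
    (List.ofFn fun k => FreeAlgebra.ι ℂ (w k)).prod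
      = ((List.ofFn w).map (FreeAlgebra.ι ℂ)).prod := by
  rw [List.map_ofFn]; rfl

theorem wordProd_eq_map {n : ℕ} (w : Fin n → Refl G) :
    wordProd w = ((List.ofFn w).map fun s => s.1).prod := by
  rw [List.map_ofFn]; rfl

/-- The entry is a pairing of two words, that is, the constant term of an element of `G`-degree
`wordProd u * (wordProd w)⁻¹`; constants have degree `1`. -/
theorem braidedFactorial_eq_zero [Finite G] {n : ℕ} {w u : Fin n → Refl G}
    (h : wordProd w ≠ wordProd u) : braidedFactorial R.braiding n w u = 0 := by
  have e := R.pair_wordSum (Pi.single w 1) (Pi.single u 1)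
  rw [Matrix.mulVec_single_one, single_one_dotProduct] at e
  change _ = braidedFactorial R.braiding n w u at e
  rw [← e, wordSum_single, wordSum_single, pair, prod_ofFn_ι, prod_ofFn_ι]
  rw [wordProd_eq_map, wordProd_eq_map] at h
  exact aug_of_mem_component (fun h' => h (mul_inv_eq_one.1 h').symm)
    (R.derAct_word_mem_component _ (Submodule.subset_span ⟨_, rfl, rfl⟩))

end RootData

end Grading

section Differences

variable {V : Type*} [AddCommGroup V] [Module ℂ V]
  {G : Subgroup (LinearMap.GeneralLinearGroup ℂ V)}

namespace RootData

variable (R : RootData G)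

/-! ### Divided differences -/

/-- A lift of the divided difference operator `p ↦ (p - s p) / α̌_s`. -/
def vecDiff (s : Refl G) : FreeAlgebra ℂ V →ₗ[ℂ] FreeAlgebra ℂ V :=
  skewDer (AlgHom.id ℂ _) (freeAct (natRep G) s.1) (R.root s)

/-- A lift of the divided difference operator `p ↦ (p - s⁻¹ p) / α_s`. -/
def covDiff (s : Refl G) :
    FreeAlgebra ℂ (Module.Dual ℂ V) →ₗ[ℂ] FreeAlgebra ℂ (Module.Dual ℂ V) :=
  skewDer (freeAct (natRep G).dual s.1⁻¹) (AlgHom.id ℂ _) fun f => f (R.coroot s)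

theorem ι_mul_vecDiff (s : Refl G) (p : FreeAlgebra ℂ V) :
    SymmetricAlgebra.ι ℂ V (R.coroot s) * freeToSym V (R.vecDiff s p)
      = freeToSym V p - symAct (natRep G) s.1 (freeToSym V p) := by
  rw [← freeToSym_freeAct]
  refine ι_mul_freeToSym_skewDer (θ₁ := AlgHom.id ℂ _) (fun v => ?_) p
  rw [AlgHom.id_apply, freeAct_ι, freeToSym_ι, freeToSym_ι, R.apply_eq, map_sub, map_smul,
    sub_sub_cancel]

theorem ι_mul_covDiff (s : Refl G) (p : FreeAlgebra ℂ (Module.Dual ℂ V)) :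
    SymmetricAlgebra.ι ℂ _ (R.root s) * freeToSym _ (R.covDiff s p)
      = freeToSym _ p - symAct (natRep G).dual s.1⁻¹ (freeToSym _ p) := by
  -- In `covDiff` the twist by `s⁻¹` stands on the left, so the general lemma yields `s⁻¹ p - p`;
  -- this forces the divisor `-α_s`.
  rw [← freeToSym_freeAct, ← neg_inj, neg_sub, ← neg_mul, ← map_neg]
  refine ι_mul_freeToSym_skewDer (θ₂ := AlgHom.id ℂ _) (fun f => ?_) p
  rw [AlgHom.id_apply, freeAct_ι, freeToSym_ι, freeToSym_ι, ← map_sub, ← map_smul]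
  congr 1
  ext v
  simp [Representation.dual_apply, Module.Dual.transpose_apply, R.apply_eq, mul_comm]

theorem vecDiff_mem_filt (s : Refl G) (n : ℕ) (p : FreeAlgebra ℂ V) (hp : p ∈ filt V (n + 1)) :
    R.vecDiff s p ∈ filt V n :=
  skewDer_mem_filt _ _ _ (τ₁ := id) (τ₂ := natRep G s.1) (fun _ => rfl) (fun v => by simp) hp

theorem covDiff_mem_filt (s : Refl G) (n : ℕ) (p : FreeAlgebra ℂ (Module.Dual ℂ V))
    (hp : p ∈ filt (Module.Dual ℂ V) (n + 1)) :
    R.covDiff s p ∈ filt (Module.Dual ℂ V) n :=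
  skewDer_mem_filt _ _ _ (τ₁ := (natRep G).dual s.1⁻¹) (τ₂ := id) (fun v => by simp)
    (fun _ => rfl) hp

/-! ### The maps on vectors and on linear forms -/

variable [Finite G] (c : Refl G → ℂ)

/-- The linear map `v ↦ ∑ c_s ⟨α_s, v⟩ y_s`. -/
def vecSum {A : Type*} [Ring A] [Algebra ℂ A] (y : Refl G → A) : V →ₗ[ℂ] A :=
  ∑ s, (c s • R.root s).smulRight (y s)

/-- The linear map `f ↦ ∑ ⟨f, α̌_s⟩ y_s`. -/
def covSum {A : Type*} [Ring A] [Algebra ℂ A] (y : Refl G → A) : Module.Dual ℂ V →ₗ[ℂ] A :=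
  ∑ s, (Module.Dual.eval ℂ V (R.coroot s)).smulRight (y s)

theorem vecSum_apply {A : Type*} [Ring A] [Algebra ℂ A] (y : Refl G → A) (v : V) :
    R.vecSum c y v = ∑ s, (c s * R.root s v) • y s := by
  simp [vecSum, LinearMap.sum_apply]

theorem covSum_apply {A : Type*} [Ring A] [Algebra ℂ A] (y : Refl G → A)
    (f : Module.Dual ℂ V) : R.covSum y f = ∑ s, f (R.coroot s) • y s := by
  simp [covSum, LinearMap.sum_apply]

/-- The extension of `v ↦ ∑ c_s ⟨α_s, v⟩ [s]` to free algebras. -/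
def vecHom : FreeAlgebra ℂ V →ₐ[ℂ] FreeAlgebra ℂ (Refl G) :=
  FreeAlgebra.lift ℂ (R.vecSum c (FreeAlgebra.ι ℂ))

/-- The extension of `f ↦ ∑ ⟨f, α̌_s⟩ [s]*` to free algebras. -/
def covHom : FreeAlgebra ℂ (Module.Dual ℂ V) →ₐ[ℂ] FreeAlgebra ℂ (Refl G) :=
  FreeAlgebra.lift ℂ (R.covSum (FreeAlgebra.ι ℂ))

theorem vecHom_ι (v : V) :
    R.vecHom c (FreeAlgebra.ι ℂ v) = ∑ s, (c s * R.root s v) • FreeAlgebra.ι ℂ s := by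
  simp [vecHom, vecSum_apply]

theorem covHom_ι (f : Module.Dual ℂ V) :
    R.covHom (FreeAlgebra.ι ℂ f) = ∑ s, f (R.coroot s) • FreeAlgebra.ι ℂ s := by
  simp [covHom, covSum_apply]

theorem map_vecHom {A : Type*} [Ring A] [Algebra ℂ A] (φ : FreeAlgebra ℂ (Refl G) →ₐ[ℂ] A)
    (p : FreeAlgebra ℂ V) :
    φ (R.vecHom c p) = FreeAlgebra.lift ℂ (R.vecSum c fun s => φ (FreeAlgebra.ι ℂ s)) p := by
  have : φ.comp (R.vecHom c) = FreeAlgebra.lift ℂ (R.vecSum c fun s => φ (FreeAlgebra.ι ℂ s)) :=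
    FreeAlgebra.hom_ext (by ext v; simp [vecHom_ι, vecSum_apply])
  exact DFunLike.congr_fun this p

theorem map_covHom {A : Type*} [Ring A] [Algebra ℂ A] (φ : FreeAlgebra ℂ (Refl G) →ₐ[ℂ] A)
    (p : FreeAlgebra ℂ (Module.Dual ℂ V)) :
    φ (R.covHom p) = FreeAlgebra.lift ℂ (R.covSum fun s => φ (FreeAlgebra.ι ℂ s)) p := by
  have : φ.comp R.covHom = FreeAlgebra.lift ℂ (R.covSum fun s => φ (FreeAlgebra.ι ℂ s)) :=
    FreeAlgebra.hom_ext (by ext v; simp [covHom_ι, covSum_apply])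
  exact DFunLike.congr_fun this p

theorem aug_vecHom (p : FreeAlgebra ℂ V) : aug _ (R.vecHom c p) = aug _ p := by
  have : (aug (Refl G)).comp (R.vecHom c) = aug V :=
    FreeAlgebra.hom_ext (by ext v; simp [vecHom_ι])
  exact DFunLike.congr_fun this p

theorem aug_covHom (p : FreeAlgebra ℂ (Module.Dual ℂ V)) : aug _ (R.covHom p) = aug _ p := by
  have : (aug (Refl G)).comp R.covHom = aug (Module.Dual ℂ V) :=
    FreeAlgebra.hom_ext (by ext v; simp [covHom_ι])
  exact DFunLike.congr_fun this p

theorem act_vecHom (hc : ∀ (g : G) (s : Refl G), c (s.conj g) = c s) (g : G)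
    (p : FreeAlgebra ℂ V) : R.act g (R.vecHom c p) = R.vecHom c (freeAct (natRep G) g p) := by
  have : (R.act g).comp (R.vecHom c) = (R.vecHom c).comp (freeAct (natRep G) g) := by
    refine FreeAlgebra.hom_ext (funext fun v => ?_)
    simp only [Function.comp_apply, AlgHom.comp_apply, freeAct_ι, vecHom_ι, map_sum, map_smul,
      act_ι]
    refine Fintype.sum_equiv (Refl.conjEquiv g) _ _ fun s => ?_
    rw [Refl.conjEquiv_apply, hc, root_conj, smul_smul, mul_assoc]
  exact DFunLike.congr_fun this p

theorem coact_covHom (g : G) (p : FreeAlgebra ℂ (Module.Dual ℂ V)) :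
    R.coact g (R.covHom p) = R.covHom (freeAct (natRep G).dual g p) := by
  have : (R.coact g).comp R.covHom = R.covHom.comp (freeAct (natRep G).dual g) := by
    refine FreeAlgebra.hom_ext (funext fun v => ?_)
    simp only [Function.comp_apply, AlgHom.comp_apply, freeAct_ι, covHom_ι, map_sum, map_smul,
      coact_ι]
    refine Fintype.sum_equiv (Refl.conjEquiv g) _ _ fun s => ?_
    rw [Refl.conjEquiv_apply, dual_coroot_conj, smul_smul, mul_comm]
  exact DFunLike.congr_fun this p

/-- The link between the two sides. Conjugation invariance of `c` makes `vecHom` equivariant, so the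
twists match, and on a vector `v` both sides equal `c_s ⟨α_s, v⟩`. -/
theorem der_vecHom (hc : ∀ (g : G) (s : Refl G), c (s.conj g) = c s) (s : Refl G)
    (p : FreeAlgebra ℂ V) :
    R.der s (R.vecHom c p) = c s • R.vecHom c (R.vecDiff s p) := by
  refine skewDer_intertwine (θ₁ := AlgHom.id ℂ _) (θ₂ := freeAct (natRep G) s.1)
    (d := R.root s) (η₁ := AlgHom.id ℂ _) (η₂ := R.act s.1)
    (e := fun t => if s = t then 1 else 0) (R.vecHom c) (c s) (fun _ => rfl)
    (fun p => R.act_vecHom c hc s.1 p) (fun v => ?_) p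
  rw [vecHom_ι, map_sum, Finset.sum_eq_single s]
  · rw [map_smul, skewDer_ι, if_pos rfl, map_one, Algebra.algebraMap_eq_smul_one]
  · intro t _ ht
    rw [map_smul, skewDer_ι, if_neg ht.symm, map_zero, smul_zero]
  · simp

theorem coder_covHom (s : Refl G) (p : FreeAlgebra ℂ (Module.Dual ℂ V)) :
    R.coder s (R.covHom p) = R.covHom (R.covDiff s p) := by
  rw [← one_smul ℂ (R.covHom (R.covDiff s p))]
  refine skewDer_intertwine (θ₁ := freeAct (natRep G).dual s.1⁻¹) (θ₂ := AlgHom.id ℂ _)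
    (d := fun f => f (R.coroot s)) (η₁ := R.coact s.1⁻¹) (η₂ := AlgHom.id ℂ _)
    (e := fun t => if s = t then 1 else 0) R.covHom 1
    (fun p => R.coact_covHom s.1⁻¹ p) (fun _ => rfl) (fun f => ?_) p
  rw [covHom_ι, map_sum, Finset.sum_eq_single s]
  · rw [map_smul, skewDer_ι, if_pos rfl, map_one, one_mul, Algebra.algebraMap_eq_smul_one]
  · intro t _ ht
    rw [map_smul, skewDer_ι, if_neg ht.symm, map_zero, smul_zero]
  · simp

/-- The image of `divKernel` has no constant terms and is stable under the braided derivations,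
hence lies in the radical. -/
theorem vecHom_mem_rightRad (hc : ∀ (g : G) (s : Refl G), c (s.conj g) = c s)
    {p : FreeAlgebra ℂ V} (hp : freeToSym V p ∈ posInvariants (natRep G)) :
    R.vecHom c p ∈ R.rightRad := by
  refine R.le_rightRad (P := (divKernel R.vecDiff).map (R.vecHom c).toLinearMap) ?_ ?_
    ⟨p, mem_divKernel _ R.ι_mul_vecDiff R.coroot_ne_zero hp, rfl⟩
  · rintro _ ⟨q, hq, rfl⟩
    exact (R.aug_vecHom c q).trans hq.1
  · rintro r _ ⟨q, hq, rfl⟩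
    rw [AlgHom.toLinearMap_apply, der_vecHom R c hc]
    exact Submodule.smul_mem _ _
      ⟨_, divKernel_stable _ R.ι_mul_vecDiff R.coroot_ne_zero r hq, rfl⟩

theorem covHom_mem_leftRad {p : FreeAlgebra ℂ (Module.Dual ℂ V)}
    (hp : freeToSym _ p ∈ posInvariants (natRep G).dual) : R.covHom p ∈ R.leftRad := by
  have hp' := mem_divKernel (γ := fun s : Refl G => s.1⁻¹) (a := R.root) (natRep G).dual
    R.ι_mul_covDiff R.root_ne_zero hp
  refine R.le_leftRad (P := (divKernel R.covDiff).map R.covHom.toLinearMap) ?_ ?_ ⟨p, hp', rfl⟩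
  · rintro _ ⟨q, hq, rfl⟩
    exact (R.aug_covHom q).trans hq.1
  · rintro r _ ⟨q, hq, rfl⟩
    rw [AlgHom.toLinearMap_apply, coder_covHom]
    have h := divKernel_stable (γ := fun s : Refl G => s.1⁻¹) (a := R.root) (natRep G).dual
      R.ι_mul_covDiff R.root_ne_zero r hq
    exact ⟨_, h, rfl⟩

/-- The preimage of the radical is stable under those divided differences for which `c_s` can be
cancelled in `der_vecHom`. This is where genericity of `c` enters. -/
theorem freeToSym_mem_span_of_vecHom (hc : ∀ (g : G) (s : Refl G), c (s.conj g) = c s)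
    (hgen : Subgroup.closure {g : G | ∃ s : Refl G, s.1 = g ∧ c s ≠ 0} = ⊤)
    {p : FreeAlgebra ℂ V} (hp : R.vecHom c p ∈ R.rightRad) :
    freeToSym V p ∈ Ideal.span (posInvariants (natRep G)) := by
  refine freeToSym_mem_span_of_stable (natRep G) R.ι_mul_vecDiff R.vecDiff_mem_filt
    {s | c s ≠ 0} ?_ (R.rightRad.comap (R.vecHom c).toLinearMap) ?_ ?_ hp
  · rw [← hgen]
    congr 1
    ext g
    exact ⟨fun ⟨s, hs, e⟩ => ⟨s, e, hs⟩, fun ⟨s, e, hs⟩ => ⟨s, hs, e⟩⟩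
  · intro q hq
    rw [← R.aug_vecHom c]
    exact R.aug_of_mem_rightRad hq
  · intro s hs q hq
    have h := R.der_mem_rightRad hq s
    rw [AlgHom.toLinearMap_apply, der_vecHom R c hc] at h
    exact (Submodule.smul_mem_iff R.rightRad hs).1 h

theorem freeToSym_mem_span_of_covHom
    (hgen : Subgroup.closure {s : G | IsReflection s} = ⊤)
    {p : FreeAlgebra ℂ (Module.Dual ℂ V)} (hp : R.covHom p ∈ R.leftRad) :
    freeToSym _ p ∈ Ideal.span (posInvariants (natRep G).dual) := by
  refine freeToSym_mem_span_of_stable (natRep G).dual (γ := fun s : Refl G => s.1⁻¹)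
    R.ι_mul_covDiff R.covDiff_mem_filt Set.univ ?_ (R.leftRad.comap R.covHom.toLinearMap) ?_ ?_ hp
  · rw [eq_top_iff, ← hgen, Subgroup.closure_le]
    intro g hg
    rw [← inv_inv g]
    exact inv_mem (Subgroup.subset_closure ⟨⟨g, hg⟩, trivial, rfl⟩)
  · intro q hq
    rw [← R.aug_covHom]
    exact R.aug_of_mem_leftRad hq
  · intro s _ q hq
    have h := R.coder_mem_leftRad hq s
    rwa [AlgHom.toLinearMap_apply, coder_covHom] at h

end RootData

end Differences

section FockSpace

variable {V : Type*} [AddCommGroup V] [Module ℂ V]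
  {G : Subgroup (LinearMap.GeneralLinearGroup ℂ V)}

namespace RootData

variable (R : RootData G)

/-! ### Operators on the Nichols algebra -/

/-- The tensor algebra of `Y_G` modulo the radical of the pairing. -/
abbrev Fock := FreeAlgebra ℂ (Refl G) ⧸ R.rightRad

/-- Left multiplication by a generator. -/
def fockMul (s : Refl G) : Module.End ℂ R.Fock :=
  R.rightRad.mapQ R.rightRad (LinearMap.mulLeft ℂ (FreeAlgebra.ι ℂ s)) fun b hb => by
    simpa using R.mul_mem_rightRad hb (FreeAlgebra.ι ℂ s) 1

/-- The action of the group. -/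
def fockAct (g : G) : Module.End ℂ R.Fock :=
  R.rightRad.mapQ R.rightRad (R.act g).toLinearMap fun _ hb => R.act_mem_rightRad g hb

/-- The braided derivations. -/
def fockDer (r : Refl G) : Module.End ℂ R.Fock :=
  R.rightRad.mapQ R.rightRad (R.der r) fun _ hb => R.der_mem_rightRad hb r

theorem fockMul_mk (s : Refl G) (b : FreeAlgebra ℂ (Refl G)) :
    R.fockMul s (Submodule.Quotient.mk b) = Submodule.Quotient.mk (FreeAlgebra.ι ℂ s * b) := rfl

theorem fockAct_mk (g : G) (b : FreeAlgebra ℂ (Refl G)) :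
    R.fockAct g (Submodule.Quotient.mk b) = Submodule.Quotient.mk (R.act g b) := rfl

theorem fockDer_mk (r : Refl G) (b : FreeAlgebra ℂ (Refl G)) :
    R.fockDer r (Submodule.Quotient.mk b) = Submodule.Quotient.mk (R.der r b) := rfl

theorem lift_fockMul_mk (x b : FreeAlgebra ℂ (Refl G)) :
    FreeAlgebra.lift ℂ R.fockMul x (Submodule.Quotient.mk b)
      = Submodule.Quotient.mk (x * b) := by
  induction x using FreeAlgebra.induction generalizing b with
  | grade0 z =>
    rw [AlgHom.commutes, Module.algebraMap_end_apply, ← Submodule.Quotient.mk_smul,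
      Algebra.smul_def]
  | grade1 s => rw [FreeAlgebra.lift_ι_apply, fockMul_mk]
  | mul x y hx hy => rw [map_mul, Module.End.mul_apply, hy, hx, mul_assoc]
  | add x y hx hy => rw [map_add, LinearMap.add_apply, hx, hy, add_mul, Submodule.Quotient.mk_add]

theorem lift_fockDer_mk (x b : FreeAlgebra ℂ (Refl G)) :
    FreeAlgebra.lift ℂ R.fockDer x (Submodule.Quotient.mk b)
      = Submodule.Quotient.mk (R.derAct x b) := by
  induction x using FreeAlgebra.induction generalizing b with
  | grade0 z =>
    rw [AlgHom.commutes, Module.algebraMap_end_apply, ← Submodule.Quotient.mk_smul,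
      AlgHom.commutes, Module.algebraMap_end_apply]
  | grade1 s => rw [FreeAlgebra.lift_ι_apply, fockDer_mk, derAct_ι]
  | mul x y hx hy => rw [map_mul, Module.End.mul_apply, hy, hx, map_mul, Module.End.mul_apply]
  | add x y hx hy =>
    rw [map_add, LinearMap.add_apply, hx, hy, map_add, LinearMap.add_apply,
      Submodule.Quotient.mk_add]

theorem lift_fockMul_eq_zero {x : FreeAlgebra ℂ (Refl G)} (hx : x ∈ R.rightRad) :
    FreeAlgebra.lift ℂ R.fockMul x = 0 := by
  ext b
  simp only [LinearMap.comp_apply, Submodule.mkQ_apply, LinearMap.zero_apply]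
  rw [lift_fockMul_mk, Submodule.Quotient.mk_eq_zero]
  simpa using R.mul_mem_rightRad hx 1 b

theorem lift_fockDer_eq_zero {x : FreeAlgebra ℂ (Refl G)} (hx : x ∈ R.leftRad) :
    FreeAlgebra.lift ℂ R.fockDer x = 0 := by
  ext b
  simp only [LinearMap.comp_apply, Submodule.mkQ_apply, LinearMap.zero_apply]
  rw [lift_fockDer_mk, R.derAct_of_mem_leftRad hx, LinearMap.zero_apply,
    Submodule.Quotient.mk_zero]

theorem fockAct_one (b : R.Fock) : R.fockAct 1 b = b := by
  induction b using Submodule.Quotient.induction_on with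
  | H b => rw [fockAct_mk, act_one]

theorem fockAct_mul (g h : G) (b : R.Fock) : R.fockAct (g * h) b = R.fockAct g (R.fockAct h b) := by
  induction b using Submodule.Quotient.induction_on with
  | H b => rw [fockAct_mk, act_mul, fockAct_mk, fockAct_mk]

theorem fockAct_fockMul (g : G) (s : Refl G) (b : R.Fock) :
    R.fockAct g (R.fockMul s b) = R.cocycle g s • R.fockMul (s.conj g) (R.fockAct g b) := by
  induction b using Submodule.Quotient.induction_on with
  | H b =>
    rw [fockMul_mk, fockAct_mk, fockAct_mk, fockMul_mk, ← Submodule.Quotient.mk_smul,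
      map_mul (R.act g), act_ι, smul_mul_assoc]

theorem fockAct_fockDer (g : G) (s : Refl G) (b : R.Fock) :
    R.fockAct g (R.fockDer s b) = (R.cocycle g s)⁻¹ • R.fockDer (s.conj g) (R.fockAct g b) := by
  induction b using Submodule.Quotient.induction_on with
  | H b =>
    rw [fockDer_mk, fockAct_mk, fockAct_mk, fockDer_mk, ← Submodule.Quotient.mk_smul,
      der_conj, inv_smul_smul₀ (R.cocycle_ne_zero g s)]

theorem fockDer_fockMul (r s : Refl G) (b : R.Fock) :
    R.fockDer r (R.fockMul s b)
      = R.fockMul s (R.fockDer r b) + if r = s then R.fockAct r.1 b else 0 := by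
  induction b using Submodule.Quotient.induction_on with
  | H b =>
    rw [fockMul_mk, fockDer_mk, fockDer_mk, fockMul_mk, fockAct_mk, der_ι_mul,
      Submodule.Quotient.mk_add]
    split_ifs <;> rfl

/-! ### A representation of the braided Heisenberg double -/

/-- The action of `[s]` on functions. -/
def opY (s : Refl G) : Module.End ℂ (G → R.Fock) :=
  LinearMap.pi fun h => R.fockMul s ∘ₗ LinearMap.proj h

/-- The action of a group element on functions. -/
def opG (g : G) : Module.End ℂ (G → R.Fock) :=
  LinearMap.pi fun h => R.fockAct g ∘ₗ LinearMap.proj (g⁻¹ * h)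

/-- The action of `[s]*` on functions. -/
def opS (r : Refl G) : Module.End ℂ (G → R.Fock) :=
  LinearMap.pi fun h => R.fockDer r ∘ₗ LinearMap.proj (r.1⁻¹ * h)

theorem opY_apply (s : Refl G) (F : G → R.Fock) (h : G) : R.opY s F h = R.fockMul s (F h) := rfl

theorem opG_apply (g : G) (F : G → R.Fock) (h : G) : R.opG g F h = R.fockAct g (F (g⁻¹ * h)) := rfl

theorem opS_apply (r : Refl G) (F : G → R.Fock) (h : G) :
    R.opS r F h = R.fockDer r (F (r.1⁻¹ * h)) := rfl

theorem lift_opY_apply (x : FreeAlgebra ℂ (Refl G)) (F : G → R.Fock) (h : G) :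
    FreeAlgebra.lift ℂ R.opY x F h = FreeAlgebra.lift ℂ R.fockMul x (F h) := by
  induction x using FreeAlgebra.induction generalizing F with
  | grade0 z =>
    rw [AlgHom.commutes, AlgHom.commutes, Module.algebraMap_end_apply,
      Module.algebraMap_end_apply, Pi.smul_apply]
  | grade1 s => rw [FreeAlgebra.lift_ι_apply, FreeAlgebra.lift_ι_apply, opY_apply]
  | mul x y hx hy => rw [map_mul, map_mul, Module.End.mul_apply, hx, hy, Module.End.mul_apply]
  | add x y hx hy =>
    rw [map_add, map_add, LinearMap.add_apply, LinearMap.add_apply, Pi.add_apply, hx, hy]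

theorem opS_list_apply (l : List (Refl G)) (F : G → R.Fock) (h : G) :
    (l.map R.opS).prod F h
      = FreeAlgebra.lift ℂ R.fockDer (l.map (FreeAlgebra.ι ℂ)).prod
        (F ((l.map fun s => s.1).prod⁻¹ * h)) := by
  induction l generalizing h with
  | nil => simp
  | cons s l ih =>
    simp only [List.map_cons, List.prod_cons]
    rw [Module.End.mul_apply, opS_apply, ih, map_mul, Module.End.mul_apply,
      FreeAlgebra.lift_ι_apply, mul_inv_rev, mul_assoc]

variable [Finite G]

theorem wordSum_opS_apply {n : ℕ} (a : (Fin n → Refl G) → ℂ) (F : G → R.Fock) (h : G) :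
    wordSum R.opS a F h
      = ∑ w, a w • FreeAlgebra.lift ℂ R.fockDer (wordSum (FreeAlgebra.ι ℂ) (Pi.single w 1))
        (F ((wordProd w)⁻¹ * h)) := by
  rw [wordSum, LinearMap.sum_apply, Finset.sum_apply]
  refine Finset.sum_congr rfl fun w _ => ?_
  rw [LinearMap.smul_apply, Pi.smul_apply, wordSum_single, prod_ofFn_ι, wordProd_eq_map,
    ← opS_list_apply, List.map_ofFn]
  rfl

open Classical in
theorem wordSum_opS_eq_zero {n : ℕ} {a : (Fin n → Refl G) → ℂ}
    (ha : braidedFactorial R.braidingᵀ n *ᵥ a = 0) : wordSum R.opS a = 0 := by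
  have := Fintype.ofFinite G
  -- Each word translates the argument by the inverse of its product in `G`, so a relation has to be
  -- split by these products. The parts are again relations because the braided factorial is block
  -- diagonal for them, and within a part all terms are evaluated at the same point `k⁻¹ h`.
  let part : G → (Fin n → Refl G) → ℂ := fun k w => if wordProd w = k then a w else 0
  have hpart : ∀ k, wordSum (FreeAlgebra.ι ℂ) (part k) ∈ R.leftRad := fun k => by
    refine R.wordSum_mem_leftRad ?_
    funext u
    rw [braidedFactorial_transpose] at ha ⊢
    have hu := congrFun ha u
    simp only [Matrix.mulVec, dotProduct, Matrix.transpose_apply, Pi.zero_apply] at hu ⊢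
    by_cases huk : wordProd u = k
    · rw [← hu]
      refine Finset.sum_congr rfl fun w _ => ?_
      by_cases hw : wordProd w = wordProd u
      · rw [show part k w = a w from if_pos (hw.trans huk)]
      · rw [R.braidedFactorial_eq_zero hw, zero_mul, zero_mul]
    · refine Finset.sum_eq_zero fun w _ => ?_
      by_cases hw : wordProd w = wordProd u
      · rw [show part k w = 0 from if_neg fun h => huk (hw.symm.trans h), mul_zero]
      · rw [R.braidedFactorial_eq_zero hw, zero_mul]
  refine LinearMap.ext fun F => funext fun h => ?_
  rw [wordSum_opS_apply, ← Finset.sum_fiberwise Finset.univ fun w => wordProd w]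
  refine Finset.sum_eq_zero fun k _ => ?_
  have e := DFunLike.congr_fun (R.lift_fockDer_eq_zero (hpart k)) (F (k⁻¹ * h))
  rw [LinearMap.zero_apply] at e
  rw [← e, wordSum, map_sum, LinearMap.sum_apply, Finset.sum_filter]
  refine Finset.sum_congr rfl fun w _ => ?_
  by_cases hw : wordProd w = k
  · rw [if_pos hw, show part k w = a w from if_pos hw, wordSum_single, hw, map_smul]
    rfl
  · rw [if_neg hw, show part k w = 0 from if_neg hw, zero_smul, map_zero]
    rfl

/-- The generators of the Heisenberg double act on functions on `G` with values in the Nichols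
algebra. -/
def heisOp : HeisGen G → Module.End ℂ (G → R.Fock)
  | .y s => R.opY s
  | .grp g => R.opG g
  | .ystar s => R.opS s

/-- The Fock representation of the Heisenberg double. -/
def fockRep : HeisDouble R →ₐ[ℂ] Module.End ℂ (G → R.Fock) :=
  RingQuot.liftAlgHom ℂ ⟨FreeAlgebra.lift ℂ R.heisOp, fun x y h => by
    induction h with
    | ker n a ha =>
      have e : FreeAlgebra.lift ℂ R.opY (wordSum (FreeAlgebra.ι ℂ) a) = 0 := by
        refine LinearMap.ext fun F => funext fun h => ?_
        rw [lift_opY_apply, R.lift_fockMul_eq_zero (R.wordSum_mem_rightRad ha)]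
        rfl
      rw [map_wordSum, map_zero]
      rw [map_wordSum] at e
      simp only [FreeAlgebra.lift_ι_apply] at e ⊢
      exact e
    | ker_star n a ha =>
      rw [map_wordSum, map_zero]
      simp only [FreeAlgebra.lift_ι_apply]
      exact R.wordSum_opS_eq_zero ha
    | grp_one =>
      rw [FreeAlgebra.lift_ι_apply, map_one]
      refine LinearMap.ext fun F => funext fun h => ?_
      change R.opG 1 F h = F h
      rw [opG_apply, fockAct_one, inv_one, one_mul]
    | grp_mul g g' =>
      rw [map_mul]
      simp only [FreeAlgebra.lift_ι_apply]
      refine LinearMap.ext fun F => funext fun h => ?_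
      change R.opG (g * g') F h = R.opG g (R.opG g' F) h
      rw [opG_apply, opG_apply, opG_apply, fockAct_mul, mul_inv_rev, mul_assoc]
    | grp_y g s =>
      rw [map_mul, map_smul, map_mul]
      simp only [FreeAlgebra.lift_ι_apply]
      refine LinearMap.ext fun F => funext fun h => ?_
      change R.opG g (R.opY s F) h = R.cocycle g s • R.opY (s.conj g) (R.opG g F) h
      rw [opG_apply, opY_apply, opY_apply, opG_apply, fockAct_fockMul]
    | grp_ystar g s =>
      rw [map_mul, map_smul, map_mul]
      simp only [FreeAlgebra.lift_ι_apply]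
      refine LinearMap.ext fun F => funext fun h => ?_
      change R.opG g (R.opS s F) h = (R.cocycle g s)⁻¹ • R.opS (s.conj g) (R.opG g F) h
      rw [opG_apply, opS_apply, opS_apply, opG_apply, fockAct_fockDer, Refl.conj_val]
      simp only [mul_inv_rev, inv_inv, mul_assoc, inv_mul_cancel_left]
    | comm r s =>
      rw [map_sub, map_mul, map_mul, apply_ite (FreeAlgebra.lift ℂ R.heisOp), map_zero]
      simp only [FreeAlgebra.lift_ι_apply]
      refine LinearMap.ext fun F => funext fun h => ?_
      change R.opS r (R.opY s F) h - R.opY s (R.opS r F) h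
        = (if r = s then R.opG s.1 else 0 : Module.End ℂ (G → R.Fock)) F h
      -- The translation by `r` built into `opS` is the one that the group element `r` on the
      -- right-hand side requires.
      rw [opS_apply, opY_apply, opY_apply, opS_apply, fockDer_fockMul, add_sub_cancel_left]
      split_ifs with hrs
      · rw [opG_apply, hrs]
      · rfl⟩

theorem fockRep_y (s : Refl G) : R.fockRep (HeisDouble.y R s) = R.opY s := by
  rw [fockRep, HeisDouble.y, RingQuot.liftAlgHom_mkAlgHom_apply, FreeAlgebra.lift_ι_apply, heisOp]

theorem fockRep_grp (g : G) : R.fockRep (HeisDouble.grp R g) = R.opG g := by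
  rw [fockRep, HeisDouble.grp, RingQuot.liftAlgHom_mkAlgHom_apply, FreeAlgebra.lift_ι_apply, heisOp]

theorem fockRep_ystar (s : Refl G) : R.fockRep (HeisDouble.ystar R s) = R.opS s := by
  rw [fockRep, HeisDouble.ystar, RingQuot.liftAlgHom_mkAlgHom_apply, FreeAlgebra.lift_ι_apply,
    heisOp]

end RootData

end FockSpace

section Homomorphisms

variable {V : Type*} [AddCommGroup V] [Module ℂ V]
  {G : Subgroup (LinearMap.GeneralLinearGroup ℂ V)} [Finite G]

namespace RootData

variable (R : RootData G) (c : Refl G → ℂ)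

/-! ### The embedding of the coinvariant algebra -/

section General

variable {A : Type*} [Ring A] [Algebra ℂ A] {y : Refl G → A}

/-- Stated for any elements that satisfy the Nichols relations, so that it serves both the Nichols
algebra and the Heisenberg double. -/
theorem lift_vecSum_eq_zero (hc : ∀ (g : G) (s : Refl G), c (s.conj g) = c s)
    (hy : ∀ (n : ℕ) (a : (Fin n → Refl G) → ℂ), braidedFactorial R.braiding n *ᵥ a = 0 →
      wordSum y a = 0)
    {p : FreeAlgebra ℂ V} (hp : freeToSym V p ∈ posInvariants (natRep G)) :
    FreeAlgebra.lift ℂ (R.vecSum c y) p = 0 := by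
  have h := R.map_eq_zero_of_mem_rightRad (FreeAlgebra.lift ℂ y)
    (fun n a ha => by simpa [map_wordSum] using hy n a ha) (R.vecHom_mem_rightRad c hc hp)
  simpa [map_vecHom] using h

theorem lift_covSum_eq_zero
    (hy : ∀ (n : ℕ) (a : (Fin n → Refl G) → ℂ), braidedFactorial R.braidingᵀ n *ᵥ a = 0 →
      wordSum y a = 0)
    {p : FreeAlgebra ℂ (Module.Dual ℂ V)}
    (hp : freeToSym _ p ∈ posInvariants (natRep G).dual) :
    FreeAlgebra.lift ℂ (R.covSum y) p = 0 := by
  have h := R.map_eq_zero_of_mem_leftRad (FreeAlgebra.lift ℂ y)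
    (fun n a ha => by simpa [map_wordSum] using hy n a ha) (R.covHom_mem_leftRad hp)
  simpa [map_covHom] using h

/-- Commutators become zero, an invariant without constant term; commutativity of the images is thus
an instance of the vanishing of invariants. -/
theorem freeToSym_commutator_mem {U Γ : Type*} [AddCommGroup U] [Module ℂ U] [Group Γ]
    (ρ : Representation ℂ Γ U) (u v : U) :
    freeToSym U (FreeAlgebra.ι ℂ u * FreeAlgebra.ι ℂ v - FreeAlgebra.ι ℂ v * FreeAlgebra.ι ℂ u)
      ∈ posInvariants ρ := by
  rw [map_sub, map_mul, map_mul, mul_comm, sub_self]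
  exact zero_mem_posInvariants ρ

theorem vecSum_comm (hc : ∀ (g : G) (s : Refl G), c (s.conj g) = c s)
    (hy : ∀ (n : ℕ) (a : (Fin n → Refl G) → ℂ), braidedFactorial R.braiding n *ᵥ a = 0 →
      wordSum y a = 0) (u v : V) :
    R.vecSum c y u * R.vecSum c y v = R.vecSum c y v * R.vecSum c y u := by
  have h := R.lift_vecSum_eq_zero c hc hy (freeToSym_commutator_mem (natRep G) u v)
  simpa [sub_eq_zero] using h

theorem covSum_comm
    (hy : ∀ (n : ℕ) (a : (Fin n → Refl G) → ℂ), braidedFactorial R.braidingᵀ n *ᵥ a = 0 →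
      wordSum y a = 0) (f f' : Module.Dual ℂ V) :
    R.covSum y f * R.covSum y f' = R.covSum y f' * R.covSum y f := by
  have h := R.lift_covSum_eq_zero hy (freeToSym_commutator_mem (natRep G).dual f f')
  simpa [sub_eq_zero] using h

end General

theorem wordSum_nicholsGen {n : ℕ} {a : (Fin n → Refl G) → ℂ}
    (ha : braidedFactorial R.braiding n *ᵥ a = 0) : wordSum (Nichols.gen R.braiding) a = 0 := by
  have h := RingQuot.mkAlgHom_rel ℂ (NicholsRel.ker n a ha)
  rwa [map_wordSum, map_zero] at h

/-- Left multiplication on the Nichols algebra, realised on the quotient by the radical. -/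
def nicholsRep : Nichols R.braiding →ₐ[ℂ] Module.End ℂ R.Fock :=
  RingQuot.liftAlgHom ℂ ⟨FreeAlgebra.lift ℂ R.fockMul, fun x y h => by
    induction h with
    | ker n a ha => rw [map_zero, R.lift_fockMul_eq_zero (R.wordSum_mem_rightRad ha)]⟩

/-- Left multiplication by `x`, applied to the class of `1`, returns the class of `x`. -/
theorem mem_rightRad_of_mkAlgHom_eq_zero {x : FreeAlgebra ℂ (Refl G)}
    (hx : RingQuot.mkAlgHom ℂ (NicholsRel R.braiding) x = 0) : x ∈ R.rightRad := by
  have h : R.nicholsRep (RingQuot.mkAlgHom ℂ (NicholsRel R.braiding) x)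
      (Submodule.Quotient.mk 1) = 0 := by rw [hx, map_zero, LinearMap.zero_apply]
  rw [nicholsRep, RingQuot.liftAlgHom_mkAlgHom_apply, lift_fockMul_mk, mul_one,
    Submodule.Quotient.mk_eq_zero] at h
  exact h

/-- The homomorphism from the coinvariant algebra to the Nichols algebra. -/
def coinvariantHom (hc : ∀ (g : G) (s : Refl G), c (s.conj g) = c s) :
    Coinvariant (natRep G) →ₐ[ℂ] Nichols R.braiding :=
  Ideal.Quotient.liftₐ _ (symLift (R.vecSum c (Nichols.gen R.braiding))
    (R.vecSum_comm c hc fun _ _ => R.wordSum_nicholsGen)) fun a ha => by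
      have hle : Ideal.span (posInvariants (natRep G)) ≤ RingHom.ker
          (symLift (R.vecSum c (Nichols.gen R.braiding))
            (R.vecSum_comm c hc fun _ _ => R.wordSum_nicholsGen)) := by
        rw [Ideal.span_le]
        intro x hx
        obtain ⟨p, rfl⟩ := freeToSym_surjective x
        rw [SetLike.mem_coe, RingHom.mem_ker, symLift_freeToSym]
        exact R.lift_vecSum_eq_zero c hc (fun _ _ => R.wordSum_nicholsGen) hx
      exact hle ha

theorem coinvariantHom_mk (hc : ∀ (g : G) (s : Refl G), c (s.conj g) = c s)
    (p : FreeAlgebra ℂ V) :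
    R.coinvariantHom c hc (Ideal.Quotient.mk _ (freeToSym V p))
      = FreeAlgebra.lift ℂ (R.vecSum c (Nichols.gen R.braiding)) p := by
  rw [← symLift_freeToSym _ (R.vecSum_comm c hc fun _ _ => R.wordSum_nicholsGen)]
  rfl

theorem coinvariantHom_injective (hc : ∀ (g : G) (s : Refl G), c (s.conj g) = c s)
    (hgen : Subgroup.closure {g : G | ∃ s : Refl G, s.1 = g ∧ c s ≠ 0} = ⊤) :
    Function.Injective (R.coinvariantHom c hc) := by
  refine (injective_iff_map_eq_zero _).2 fun x hx => ?_
  obtain ⟨x, rfl⟩ := Ideal.Quotient.mk_surjective x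
  obtain ⟨p, rfl⟩ := freeToSym_surjective x
  rw [coinvariantHom_mk] at hx
  refine Ideal.Quotient.eq_zero_iff_mem.2 (R.freeToSym_mem_span_of_vecHom c hc hgen
    (R.mem_rightRad_of_mkAlgHom_eq_zero ?_))
  rw [map_vecHom]
  exact hx

/-! ### The homomorphism to the Heisenberg double -/

theorem wordSum_y {n : ℕ} {a : (Fin n → Refl G) → ℂ}
    (ha : braidedFactorial R.braiding n *ᵥ a = 0) : wordSum (HeisDouble.y R) a = 0 := by
  have h := RingQuot.mkAlgHom_rel ℂ (HeisRel.ker n a ha)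
  rwa [map_wordSum, map_zero] at h

theorem wordSum_ystar {n : ℕ} {a : (Fin n → Refl G) → ℂ}
    (ha : braidedFactorial R.braidingᵀ n *ᵥ a = 0) : wordSum (HeisDouble.ystar R) a = 0 := by
  have h := RingQuot.mkAlgHom_rel ℂ (HeisRel.ker_star n a ha)
  rwa [map_wordSum, map_zero] at h

theorem grp_mul_y (g : G) (s : Refl G) :
    HeisDouble.grp R g * HeisDouble.y R s
      = R.cocycle g s • (HeisDouble.y R (s.conj g) * HeisDouble.grp R g) := by
  have h := RingQuot.mkAlgHom_rel ℂ (HeisRel.grp_y (R := R) g s)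
  rwa [map_mul, map_smul, map_mul] at h

theorem grp_mul_ystar (g : G) (s : Refl G) :
    HeisDouble.grp R g * HeisDouble.ystar R s
      = (R.cocycle g s)⁻¹ • (HeisDouble.ystar R (s.conj g) * HeisDouble.grp R g) := by
  have h := RingQuot.mkAlgHom_rel ℂ (HeisRel.grp_ystar (R := R) g s)
  rwa [map_mul, map_smul, map_mul] at h

theorem ystar_mul_y_sub (r s : Refl G) :
    HeisDouble.ystar R r * HeisDouble.y R s - HeisDouble.y R s * HeisDouble.ystar R r
      = if r = s then HeisDouble.grp R s.1 else 0 := by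
  have h := RingQuot.mkAlgHom_rel ℂ (HeisRel.comm (R := R) r s)
  rwa [map_sub, map_mul, map_mul, apply_ite (RingQuot.mkAlgHom ℂ (HeisRel R)), map_zero] at h

theorem grp_mul_vecSum (hc : ∀ (g : G) (s : Refl G), c (s.conj g) = c s) (g : G) (v : V) :
    HeisDouble.grp R g * R.vecSum c (HeisDouble.y R) v
      = R.vecSum c (HeisDouble.y R) (natRep G g v) * HeisDouble.grp R g := by
  rw [vecSum_apply, vecSum_apply, Finset.mul_sum, Finset.sum_mul]
  refine Fintype.sum_equiv (Refl.conjEquiv g) _ _ fun s => ?_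
  rw [Refl.conjEquiv_apply, hc, root_conj, mul_smul_comm, grp_mul_y, smul_smul, smul_mul_assoc,
    mul_assoc]

theorem grp_mul_covSum (g : G) (f : Module.Dual ℂ V) :
    HeisDouble.grp R g * R.covSum (HeisDouble.ystar R) f
      = R.covSum (HeisDouble.ystar R) ((natRep G).dual g f) * HeisDouble.grp R g := by
  rw [covSum_apply, covSum_apply, Finset.mul_sum, Finset.sum_mul]
  refine Fintype.sum_equiv (Refl.conjEquiv g) _ _ fun s => ?_
  rw [Refl.conjEquiv_apply, dual_coroot_conj, mul_smul_comm, grp_mul_ystar, smul_smul,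
    smul_mul_assoc, mul_comm (f _)]

theorem smul_commutator {A : Type*} [Ring A] [Algebra ℂ A] (a b : ℂ) (x y : A) :
    (a • x) * (b • y) - (b • y) * (a • x) = (b * a) • (x * y - y * x) := by
  rw [smul_mul_smul_comm, smul_mul_smul_comm, mul_comm a, ← smul_sub]

theorem covSum_mul_vecSum_sub (f : Module.Dual ℂ V) (v : V) :
    R.covSum (HeisDouble.ystar R) f * R.vecSum c (HeisDouble.y R) v
        - R.vecSum c (HeisDouble.y R) v * R.covSum (HeisDouble.ystar R) f
      = ∑ s, (c s * f (v - natRep G s.1 v)) • HeisDouble.grp R s.1 := by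
  have h : ∀ r s : Refl G,
      (f (R.coroot r) • HeisDouble.ystar R r) * ((c s * R.root s v) • HeisDouble.y R s)
        - ((c s * R.root s v) • HeisDouble.y R s) * (f (R.coroot r) • HeisDouble.ystar R r)
      = if r = s then (c s * f (v - natRep G s.1 v)) • HeisDouble.grp R s.1 else 0 := by
    intro r s
    refine ((smul_commutator (f (R.coroot r)) (c s * R.root s v) (HeisDouble.ystar R r)
      (HeisDouble.y R s)).trans (congrArg _ (R.ystar_mul_y_sub r s))).trans ?_
    split_ifs with hrs
    · rw [hrs, R.apply_eq, sub_sub_cancel, map_smul, smul_eq_mul, mul_assoc]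
    · rw [smul_zero]
  rw [vecSum_apply, covSum_apply, Finset.sum_mul_sum, Finset.sum_mul_sum,
    Finset.sum_comm (γ := Refl G), ← Finset.sum_sub_distrib]
  simp only [← Finset.sum_sub_distrib, h]
  simp

/-- The images of the generators of the rational Cherednik algebra. -/
def cherGenImage : CherGen G → HeisDouble R
  | .vec v => R.vecSum c (HeisDouble.y R) v
  | .grp g => HeisDouble.grp R g
  | .cov f => R.covSum (HeisDouble.ystar R) f

/-- The homomorphism from the rational Cherednik algebra to the Heisenberg double. -/
def ratCherHom (hc : ∀ (g : G) (s : Refl G), c (s.conj g) = c s) :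
    RatCher 0 c →ₐ[ℂ] HeisDouble R :=
  RingQuot.liftAlgHom ℂ ⟨FreeAlgebra.lift ℂ (R.cherGenImage c), fun x y h => by
    induction h with
    | vec_add v w => simp [cherGenImage]
    | vec_smul z v => simp [cherGenImage]
    | cov_add f f' => simp [cherGenImage]
    | cov_smul z f => simp [cherGenImage]
    | grp_one =>
      simpa [cherGenImage, HeisDouble.grp] using RingQuot.mkAlgHom_rel ℂ (HeisRel.grp_one (R := R))
    | grp_mul g h =>
      simpa [cherGenImage, HeisDouble.grp] using RingQuot.mkAlgHom_rel ℂ (HeisRel.grp_mul (R := R) g h)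
    | vec_comm v w =>
      simpa [cherGenImage] using R.vecSum_comm c hc (fun _ _ => R.wordSum_y) v w
    | cov_comm f f' =>
      simpa [cherGenImage] using R.covSum_comm (fun _ _ => R.wordSum_ystar) f f'
    | grp_vec g v => simpa [cherGenImage] using R.grp_mul_vecSum c hc g v
    | grp_cov g f => simpa [cherGenImage] using R.grp_mul_covSum g f
    | cov_vec f v => simpa [cherGenImage] using R.covSum_mul_vecSum_sub c f v⟩

variable {c}

theorem ratCherHom_vec (hc : ∀ (g : G) (s : Refl G), c (s.conj g) = c s) (v : V) :
    R.ratCherHom c hc (RatCher.vec 0 c v) = R.vecSum c (HeisDouble.y R) v := by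
  change R.ratCherHom c hc (RingQuot.mkAlgHom ℂ _ _) = _
  rw [ratCherHom, RingQuot.liftAlgHom_mkAlgHom_apply, FreeAlgebra.lift_ι_apply, cherGenImage]

theorem ratCherHom_cov (hc : ∀ (g : G) (s : Refl G), c (s.conj g) = c s)
    (f : Module.Dual ℂ V) :
    R.ratCherHom c hc (RatCher.cov 0 c f) = R.covSum (HeisDouble.ystar R) f := by
  change R.ratCherHom c hc (RingQuot.mkAlgHom ℂ _ _) = _
  rw [ratCherHom, RingQuot.liftAlgHom_mkAlgHom_apply, FreeAlgebra.lift_ι_apply, cherGenImage]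

theorem ratCherHom_grp (hc : ∀ (g : G) (s : Refl G), c (s.conj g) = c s) (g : G) :
    R.ratCherHom c hc (RatCher.grp 0 c g) = HeisDouble.grp R g := by
  rw [RatCher.grp, ratCherHom, RingQuot.liftAlgHom_mkAlgHom_apply, FreeAlgebra.lift_ι_apply,
    cherGenImage]

/-- The homomorphism from the restricted Cherednik algebra to the Heisenberg double. -/
def restrCherHom (hc : ∀ (g : G) (s : Refl G), c (s.conj g) = c s) :
    RestrCher c →ₐ[ℂ] HeisDouble R :=
  RingQuot.liftAlgHom ℂ ⟨R.ratCherHom c hc, fun x y h => by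
    induction h with
    | vec x hx =>
      obtain ⟨p, rfl⟩ := freeToTensor_surjective x
      rw [algHom_freeToTensor] at hx
      have e : (R.ratCherHom c hc).comp (FreeAlgebra.lift ℂ (RatCher.vec 0 c))
          = FreeAlgebra.lift ℂ (R.vecSum c (HeisDouble.y R)) :=
        FreeAlgebra.hom_ext (by ext v; simp [ratCherHom_vec])
      rw [tensorLift_freeToTensor, ← AlgHom.comp_apply, e, map_zero,
        R.lift_vecSum_eq_zero c hc (fun _ _ => R.wordSum_y) hx]
    | cov x hx =>
      obtain ⟨p, rfl⟩ := freeToTensor_surjective x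
      rw [algHom_freeToTensor] at hx
      have e : (R.ratCherHom c hc).comp (FreeAlgebra.lift ℂ (RatCher.cov 0 c))
          = FreeAlgebra.lift ℂ (R.covSum (HeisDouble.ystar R)) :=
        FreeAlgebra.hom_ext (by ext v; simp [ratCherHom_cov])
      rw [tensorLift_freeToTensor, ← AlgHom.comp_apply, e, map_zero,
        R.lift_covSum_eq_zero (fun _ _ => R.wordSum_ystar) hx]⟩

theorem restrCherHom_vec (hc : ∀ (g : G) (s : Refl G), c (s.conj g) = c s) (v : V) :
    R.restrCherHom hc (RestrCher.vec c v) = R.vecSum c (HeisDouble.y R) v := by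
  rw [RestrCher.vec, restrCherHom, RingQuot.liftAlgHom_mkAlgHom_apply, ratCherHom_vec]

theorem restrCherHom_cov (hc : ∀ (g : G) (s : Refl G), c (s.conj g) = c s)
    (f : Module.Dual ℂ V) :
    R.restrCherHom hc (RestrCher.cov c f) = R.covSum (HeisDouble.ystar R) f := by
  rw [RestrCher.cov, restrCherHom, RingQuot.liftAlgHom_mkAlgHom_apply, ratCherHom_cov]

theorem restrCherHom_grp (hc : ∀ (g : G) (s : Refl G), c (s.conj g) = c s) (g : G) :
    R.restrCherHom hc (RestrCher.grp c g) = HeisDouble.grp R g := by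
  rw [RestrCher.grp, restrCherHom, RingQuot.liftAlgHom_mkAlgHom_apply, ratCherHom_grp]

end RootData

end Homomorphisms

section NormalOrder

/-! ### Relations in the restricted Cherednik algebra -/

theorem lift_eq_zero_of_mem_span {U Γ A : Type*} [AddCommGroup U] [Module ℂ U] [Group Γ] [Ring A]
    [Algebra ℂ A] {ρ : Representation ℂ Γ U} (f : U →ₗ[ℂ] A) (hf : ∀ u v, f u * f v = f v * f u)
    (h : ∀ p, freeToSym U p ∈ posInvariants ρ → FreeAlgebra.lift ℂ f p = 0)
    {p : FreeAlgebra ℂ U} (hp : freeToSym U p ∈ Ideal.span (posInvariants ρ)) :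
    FreeAlgebra.lift ℂ f p = 0 := by
  have hle : Ideal.span (posInvariants ρ) ≤ RingHom.ker (symLift f hf) := by
    rw [Ideal.span_le]
    intro x hx
    obtain ⟨q, rfl⟩ := freeToSym_surjective x
    rw [SetLike.mem_coe, RingHom.mem_ker, symLift_freeToSym, h q hx]
  have e : symLift f hf (freeToSym U p) = 0 := hle hp
  rwa [symLift_freeToSym] at e

theorem exists_comp_eq_of_ker_le {K E F H : Type*} [Field K] [AddCommGroup E] [Module K E]
    [AddCommGroup F] [Module K F] [AddCommGroup H] [Module K H] (φ : E →ₗ[K] F) (ψ : E →ₗ[K] H)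
    (h : LinearMap.ker φ ≤ LinearMap.ker ψ) : ∃ τ : F →ₗ[K] H, τ ∘ₗ φ = ψ := by
  obtain ⟨l, hl⟩ := LinearMap.exists_leftInverse_of_injective
    ((LinearMap.ker φ).liftQ φ le_rfl) (Submodule.ker_liftQ_eq_bot _ _ _ le_rfl)
  refine ⟨(LinearMap.ker φ).liftQ ψ h ∘ₗ l, ?_⟩
  ext e
  have := LinearMap.congr_fun hl (Submodule.Quotient.mk e)
  simp only [LinearMap.comp_apply, Submodule.liftQ_apply, LinearMap.id_apply] at this ⊢
  rw [this, Submodule.liftQ_apply]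

variable {V : Type*} [AddCommGroup V] [Module ℂ V]
  {G : Subgroup (LinearMap.GeneralLinearGroup ℂ V)} [Finite G]

namespace RestrCher

variable (c : Refl G → ℂ)

/-- The linear map from `V` to the restricted Cherednik algebra. -/
def vecₗ : V →ₗ[ℂ] RestrCher c := (RingQuot.mkAlgHom ℂ (RestrRel c)).toLinearMap ∘ₗ RatCher.vec 0 c

/-- The linear map from `V*` to the restricted Cherednik algebra. -/
def covₗ : Module.Dual ℂ V →ₗ[ℂ] RestrCher c :=
  (RingQuot.mkAlgHom ℂ (RestrRel c)).toLinearMap ∘ₗ RatCher.cov 0 c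

/-- The projection from the free algebra to the restricted Cherednik algebra. -/
def proj : FreeAlgebra ℂ (CherGen G) →ₐ[ℂ] RestrCher c :=
  (RingQuot.mkAlgHom ℂ (RestrRel c)).comp (RingQuot.mkAlgHom ℂ (CherRel 0 c))

theorem proj_surjective : Function.Surjective (proj c) :=
  (RingQuot.mkAlgHom_surjective ℂ _).comp (RingQuot.mkAlgHom_surjective ℂ _)

theorem proj_vec (v : V) : proj c (FreeAlgebra.ι ℂ (.vec v)) = vecₗ c v := rfl

theorem proj_cov (f : Module.Dual ℂ V) : proj c (FreeAlgebra.ι ℂ (.cov f)) = covₗ c f := rfl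

theorem proj_grp (g : G) : proj c (FreeAlgebra.ι ℂ (.grp g)) = grp c g := rfl

theorem proj_rel {x y : FreeAlgebra ℂ (CherGen G)} (h : CherRel 0 c x y) : proj c x = proj c y :=
  congrArg (RingQuot.mkAlgHom ℂ (RestrRel c)) (RingQuot.mkAlgHom_rel ℂ h)

theorem grp_one : grp c (1 : G) = 1 := by
  simpa [proj_grp] using proj_rel c (CherRel.grp_one (t := 0) (c := c))

theorem grp_mul (g h : G) : grp c (g * h) = grp c g * grp c h := by
  simpa [proj_grp] using proj_rel c (CherRel.grp_mul (t := 0) (c := c) g h)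

theorem vec_comm (v w : V) : vecₗ c v * vecₗ c w = vecₗ c w * vecₗ c v := by
  simpa [proj_vec] using proj_rel c (CherRel.vec_comm (t := 0) (c := c) v w)

theorem cov_comm (f f' : Module.Dual ℂ V) : covₗ c f * covₗ c f' = covₗ c f' * covₗ c f := by
  simpa [proj_cov] using proj_rel c (CherRel.cov_comm (t := 0) (c := c) f f')

theorem grp_mul_vec (g : G) (v : V) : grp c g * vecₗ c v = vecₗ c (natRep G g v) * grp c g := by
  simpa [proj_vec, proj_grp] using proj_rel c (CherRel.grp_vec (t := 0) (c := c) g v)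

theorem grp_mul_cov (g : G) (f : Module.Dual ℂ V) :
    grp c g * covₗ c f = covₗ c ((natRep G).dual g f) * grp c g := by
  simpa [proj_cov, proj_grp] using proj_rel c (CherRel.grp_cov (t := 0) (c := c) g f)

theorem cov_mul_vec (f : Module.Dual ℂ V) (v : V) :
    covₗ c f * vecₗ c v = vecₗ c v * covₗ c f
      + ∑ s : Refl G, (c s * f (v - natRep G s.1 v)) • grp c s.1 := by
  have h := proj_rel c (CherRel.cov_vec (t := 0) (c := c) f v)
  rw [zero_mul, map_zero, zero_add, map_sub, map_mul, map_mul, map_sum] at h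
  simp only [map_smul, proj_cov, proj_vec, proj_grp] at h
  rw [← h, add_sub_cancel]

theorem lift_vec_eq_zero {p : FreeAlgebra ℂ V}
    (hp : freeToSym V p ∈ Ideal.span (posInvariants (natRep G))) :
    FreeAlgebra.lift ℂ (vecₗ c) p = 0 := by
  refine lift_eq_zero_of_mem_span (A := RestrCher c) (ρ := natRep G) (vecₗ c) (vec_comm c)
    (fun q hq => ?_) hp
  have h := RingQuot.mkAlgHom_rel ℂ (RestrRel.vec (c := c) (freeToTensor V q)
    (by rwa [algHom_freeToTensor]))
  rw [tensorLift_freeToTensor, map_zero, ← AlgHom.comp_apply] at h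
  rw [← h]
  congr 1
  exact FreeAlgebra.hom_ext (by ext v; simp [vecₗ])

theorem lift_cov_eq_zero {p : FreeAlgebra ℂ (Module.Dual ℂ V)}
    (hp : freeToSym _ p ∈ Ideal.span (posInvariants (natRep G).dual)) :
    FreeAlgebra.lift ℂ (covₗ c) p = 0 := by
  refine lift_eq_zero_of_mem_span (A := RestrCher c) (ρ := (natRep G).dual) (covₗ c) (cov_comm c)
    (fun q hq => ?_) hp
  have h := RingQuot.mkAlgHom_rel ℂ (RestrRel.cov (c := c) (freeToTensor _ q)
    (by rwa [algHom_freeToTensor]))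
  rw [tensorLift_freeToTensor, map_zero, ← AlgHom.comp_apply] at h
  rw [← h]
  congr 1
  exact FreeAlgebra.hom_ext (by ext v; simp [covₗ])

/-! ### Normal ordering in the restricted Cherednik algebra. -/

/-- The product of vectors, a group element and linear forms. -/
def monomial (l : List V) (g : G) (l' : List (Module.Dual ℂ V)) : RestrCher c :=
  (l.map (vecₗ c)).prod * grp c g * (l'.map (covₗ c)).prod

/-- The span of the monomials in normal order. -/
def normalSpan : Submodule ℂ (RestrCher c) :=
  Submodule.span ℂ {x | ∃ l g l', x = monomial c l g l'}

theorem mul_mem_normalSpan {a : RestrCher c} (ha : ∀ l g l', a * monomial c l g l' ∈ normalSpan c)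
    {x : RestrCher c} (hx : x ∈ normalSpan c) : a * x ∈ normalSpan c := by
  induction hx using Submodule.span_induction with
  | mem _ h =>
    obtain ⟨l, g, l', rfl⟩ := h
    exact ha l g l'
  | zero => rw [mul_zero]; exact zero_mem _
  | add _ _ _ _ hx hy => rw [mul_add]; exact add_mem hx hy
  | smul z _ _ hx => rw [mul_smul_comm]; exact Submodule.smul_mem _ _ hx

theorem vec_mul_monomial (v : V) (l : List V) (g : G) (l' : List (Module.Dual ℂ V)) :
    vecₗ c v * monomial c l g l' = monomial c (v :: l) g l' := by
  simp only [monomial, List.map_cons, List.prod_cons, mul_assoc]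

theorem grp_mul_monomial (h : G) (l : List V) (g : G) (l' : List (Module.Dual ℂ V)) :
    grp c h * monomial c l g l' = monomial c (l.map (natRep G h)) (h * g) l' := by
  induction l with
  | nil => simp only [monomial, List.map_nil, List.prod_nil, one_mul, grp_mul, mul_assoc]
  | cons v l ih =>
    rw [← vec_mul_monomial, ← mul_assoc, grp_mul_vec, mul_assoc, ih, vec_mul_monomial,
      List.map_cons]

theorem cov_mul_monomial_mem (f : Module.Dual ℂ V) (l : List V) (g : G)
    (l' : List (Module.Dual ℂ V)) : covₗ c f * monomial c l g l' ∈ normalSpan c := by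
  have hmem : ∀ l g l', monomial c l g l' ∈ normalSpan c := fun l g l' =>
    Submodule.subset_span ⟨l, g, l', rfl⟩
  induction l with
  | nil =>
    have e : covₗ c f * monomial c [] g l'
        = monomial c [] g ((natRep G).dual g⁻¹ f :: l') := by
      simp only [monomial, List.map_nil, List.prod_nil, one_mul, List.map_cons, List.prod_cons]
      rw [← mul_assoc (grp c g), grp_mul_cov, ← Module.End.mul_apply, ← map_mul, mul_inv_cancel,
        map_one, Module.End.one_apply, mul_assoc]
    rw [e]
    exact hmem _ _ _
  | cons v l ih =>
    rw [← vec_mul_monomial, ← mul_assoc, cov_mul_vec, add_mul, mul_assoc, Finset.sum_mul]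
    refine add_mem (mul_mem_normalSpan c (fun l g l' => ?_) ih) (sum_mem fun s _ => ?_)
    · rw [vec_mul_monomial]
      exact hmem _ _ _
    · rw [smul_mul_assoc, grp_mul_monomial]
      exact Submodule.smul_mem _ _ (hmem _ _ _)

/-- The span contains `1` and is stable under left multiplication by generators. Only spanning is
needed, not linear independence. -/
theorem mem_normalSpan (z : RestrCher c) : z ∈ normalSpan c := by
  have hmem : ∀ l g l', monomial c l g l' ∈ normalSpan c := fun l g l' =>
    Submodule.subset_span ⟨l, g, l', rfl⟩
  suffices h : ∀ (x : FreeAlgebra ℂ (CherGen G)), ∀ y ∈ normalSpan c,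
      proj c x * y ∈ normalSpan c by
    obtain ⟨x, rfl⟩ := proj_surjective c z
    have h1 := h x 1 (by simpa [monomial, grp_one] using hmem [] 1 [])
    rwa [mul_one] at h1
  intro x
  induction x using FreeAlgebra.induction with
  | grade0 r =>
    intro y hy
    rw [AlgHom.commutes, ← Algebra.smul_def]
    exact Submodule.smul_mem _ _ hy
  | grade1 x =>
    intro y hy
    refine mul_mem_normalSpan c (fun l g l' => ?_) hy
    cases x with
    | vec v => rw [proj_vec, vec_mul_monomial]; exact hmem _ _ _
    | grp h => rw [proj_grp, grp_mul_monomial]; exact hmem _ _ _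
    | cov f => exact cov_mul_monomial_mem c f l g l'
  | mul x x' hx hx' =>
    intro y hy
    rw [map_mul, mul_assoc]
    exact hx _ (hx' _ hy)
  | add x x' hx hx' =>
    intro y hy
    rw [map_add, add_mul]
    exact add_mem (hx _ hy) (hx' _ hy)

/-- The subspace `S(V) ℂG`. -/
def borel : Submodule ℂ (RestrCher c) :=
  Submodule.span ℂ {x | ∃ (p : FreeAlgebra ℂ V) (g : G),
    x = FreeAlgebra.lift ℂ (vecₗ c) p * grp c g}

/-- The subspace of the elements of degree `d` in the linear forms. -/
def covDegree (d : ℕ) : Submodule ℂ (RestrCher c) :=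
  Submodule.span ℂ {x | ∃ u ∈ borel c, ∃ f : Fin d → Module.Dual ℂ V,
    x = u * (List.ofFn fun k => covₗ c (f k)).prod}

/-- The sum is not claimed to be direct; any decomposition will do. -/
theorem mem_iSup_covDegree (z : RestrCher c) : z ∈ ⨆ d, covDegree c d := by
  refine Submodule.span_le.2 ?_ (mem_normalSpan c z)
  rintro _ ⟨l, g, l', rfl⟩
  refine Submodule.mem_iSup_of_mem l'.length (Submodule.subset_span
    ⟨(l.map (vecₗ c)).prod * grp c g, Submodule.subset_span
      ⟨(l.map (FreeAlgebra.ι ℂ)).prod, g, ?_⟩, l'.get, ?_⟩)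
  · rw [map_list_prod, List.map_map]
    congr 3
    funext v
    simp
  · rw [monomial]
    congr 2
    conv_lhs => rw [← List.ofFn_get l', List.map_ofFn]
    rfl

end RestrCher

end NormalOrder

section Faithful

variable {V : Type*} [AddCommGroup V] [Module ℂ V]
  {G : Subgroup (LinearMap.GeneralLinearGroup ℂ V)}

namespace RootData

variable (R : RootData G) {c : Refl G → ℂ}

/-! ### Injectivity -/

open Classical in
/-- The function supported at `g` with value `b`. -/
def delta (g : G) (b : FreeAlgebra ℂ (Refl G)) : G → R.Fock :=
  fun h => if h = g then Submodule.Quotient.mk b else 0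

theorem closure_of_forall_ne_zero (hgen : Subgroup.closure {s : G | IsReflection s} = ⊤)
    (h : ∀ s, c s ≠ 0) : Subgroup.closure {g : G | ∃ s : Refl G, s.1 = g ∧ c s ≠ 0} = ⊤ := by
  rw [eq_top_iff, ← hgen]
  exact Subgroup.closure_mono fun g hg => ⟨⟨g, hg⟩, rfl, h _⟩

theorem lift_fockDer_delta (x : FreeAlgebra ℂ (Refl G)) (g h : G) (b : FreeAlgebra ℂ (Refl G)) :
    FreeAlgebra.lift ℂ R.fockDer x (R.delta g b h) = R.delta g (R.derAct x b) h := by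
  unfold delta
  split_ifs
  · rw [lift_fockDer_mk]
  · rw [map_zero]

variable [Finite G]

/-- The word `w` in the free algebra. -/
abbrev word {n : ℕ} (w : Fin n → Refl G) : FreeAlgebra ℂ (Refl G) :=
  wordSum (FreeAlgebra.ι ℂ) (Pi.single w 1)

/-- Only words with the same product in `G` as `w` pair nontrivially with `w`, and they all
translate the support `(wordProd w)⁻¹` to `1`. The result is the vacuum vector times a scalar. -/
theorem wordSum_opS_delta {n : ℕ} (a : (Fin n → Refl G) → ℂ) (w : Fin n → Refl G) :
    wordSum R.opS a (R.delta (wordProd w)⁻¹ (word w))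
      = R.pair (wordSum (FreeAlgebra.ι ℂ) a) (word w) • R.delta 1 1 := by
  funext h
  rw [wordSum_opS_apply, pair_wordSum, Matrix.mulVec_single_one, dotProduct, Pi.smul_apply,
    Finset.sum_smul]
  refine Finset.sum_congr rfl fun w' _ => ?_
  rw [lift_fockDer_delta, derAct_wordSum, Matrix.mulVec_single_one, single_one_dotProduct, mul_smul]
  congr 1
  simp only [Matrix.col_apply]
  by_cases hw : wordProd w' = wordProd w
  · unfold delta
    rw [hw]
    by_cases hh : h = 1
    · rw [if_pos (by rw [hh, mul_one]), if_pos hh, Algebra.algebraMap_eq_smul_one,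
        Submodule.Quotient.mk_smul]
    · rw [if_neg (by simpa using hh), if_neg hh, smul_zero]
  · rw [R.braidedFactorial_eq_zero hw, zero_smul, map_zero]
    unfold delta
    split_ifs <;> rfl

theorem wordSum_opS_delta_of_lt {n m : ℕ} (hmn : m < n) (a : (Fin n → Refl G) → ℂ) (g : G)
    (w : Fin m → Refl G) : wordSum R.opS a (R.delta g (word w)) = 0 := by
  funext h
  rw [wordSum_opS_apply, Pi.zero_apply]
  refine Finset.sum_eq_zero fun w' _ => ?_
  rw [lift_fockDer_delta, R.derAct_wordSum_of_lt hmn]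
  unfold delta
  split_ifs <;> simp

/-- The product of linear forms in the free algebra. -/
abbrev covWord {n : ℕ} (f : Fin n → Module.Dual ℂ V) : FreeAlgebra ℂ (Module.Dual ℂ V) :=
  (List.ofFn fun k => FreeAlgebra.ι ℂ (f k)).prod

theorem exists_covHom_covWord {n : ℕ} (f : Fin n → Module.Dual ℂ V) :
    ∃ a : (Fin n → Refl G) → ℂ, R.covHom (covWord f) = wordSum (FreeAlgebra.ι ℂ) a := by
  induction n with
  | zero => exact ⟨fun _ => 1, by rw [wordSum_zero, covWord, List.ofFn_zero]; simp⟩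
  | succ n ih =>
    obtain ⟨a, ha⟩ := ih fun k => f k.castSucc
    refine ⟨fun w => f (Fin.last n) (R.coroot (w (Fin.last n))) • a (Fin.init w), ?_⟩
    rw [covWord, List.ofFn_succ', List.concat_eq_append, List.prod_append, List.prod_singleton,
      map_mul, ha, covHom_ι, wordSum_succ, Finset.mul_sum]
    refine Finset.sum_congr rfl fun s _ => ?_
    have e : slice (fun w : Fin (n + 1) → Refl G =>
        f (Fin.last n) (R.coroot (w (Fin.last n))) • a (Fin.init w)) s
        = f (Fin.last n) (R.coroot s) • a := by
      funext u
      simp [slice]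
    rw [e, wordSum_smul, smul_mul_assoc, mul_smul_comm]

variable (hc : ∀ (g : G) (s : Refl G), c (s.conj g) = c s)

/-- The Fock representation of the restricted Cherednik algebra. -/
def restrRep : RestrCher c →ₐ[ℂ] Module.End ℂ (G → R.Fock) := R.fockRep.comp (R.restrCherHom hc)

theorem restrRep_vec (p : FreeAlgebra ℂ V) :
    R.restrRep hc (FreeAlgebra.lift ℂ (RestrCher.vecₗ c) p)
      = FreeAlgebra.lift ℂ R.opY (R.vecHom c p) := by
  have : (R.restrRep hc).comp (FreeAlgebra.lift ℂ (RestrCher.vecₗ c))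
      = (FreeAlgebra.lift ℂ R.opY).comp (R.vecHom c) := by
    refine FreeAlgebra.hom_ext (funext fun v => ?_)
    simp only [Function.comp_apply, AlgHom.comp_apply, FreeAlgebra.lift_ι_apply, vecHom_ι, map_sum,
      map_smul]
    change R.fockRep (R.restrCherHom hc (RestrCher.vec c v)) = _
    rw [restrCherHom_vec, vecSum_apply, map_sum]
    simp only [map_smul, fockRep_y]
  exact DFunLike.congr_fun this p

theorem restrRep_cov (q : FreeAlgebra ℂ (Module.Dual ℂ V)) :
    R.restrRep hc (FreeAlgebra.lift ℂ (RestrCher.covₗ c) q)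
      = FreeAlgebra.lift ℂ R.opS (R.covHom q) := by
  have : (R.restrRep hc).comp (FreeAlgebra.lift ℂ (RestrCher.covₗ c))
      = (FreeAlgebra.lift ℂ R.opS).comp R.covHom := by
    refine FreeAlgebra.hom_ext (funext fun f => ?_)
    simp only [Function.comp_apply, AlgHom.comp_apply, FreeAlgebra.lift_ι_apply, covHom_ι, map_sum,
      map_smul]
    change R.fockRep (R.restrCherHom hc (RestrCher.cov c f)) = _
    rw [restrCherHom_cov, covSum_apply, map_sum]
    simp only [map_smul, fockRep_ystar]
  exact DFunLike.congr_fun this q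

theorem restrRep_grp (g : G) : R.restrRep hc (RestrCher.grp c g) = R.opG g := by
  change R.fockRep (R.restrCherHom hc _) = _
  rw [restrCherHom_grp, fockRep_grp]

theorem lift_covWord {n : ℕ} (f : Fin n → Module.Dual ℂ V) :
    FreeAlgebra.lift ℂ (RestrCher.covₗ c) (covWord f)
      = (List.ofFn fun k => RestrCher.covₗ c (f k)).prod := by
  rw [map_list_prod, List.map_ofFn]
  congr 2
  funext k
  simp

theorem restrRep_covWord {n : ℕ} (f : Fin n → Module.Dual ℂ V) {a : (Fin n → Refl G) → ℂ}
    (ha : R.covHom (covWord f) = wordSum (FreeAlgebra.ι ℂ) a) :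
    R.restrRep hc (List.ofFn fun k => RestrCher.covₗ c (f k)).prod = wordSum R.opS a := by
  rw [← lift_covWord, restrRep_cov, ha, map_wordSum]
  simp only [FreeAlgebra.lift_ι_apply]

/-- The part `S(V) ℂG` acts faithfully on the vacuum: the position in `G` records the group element,
and the value records the image of the polynomial in the Nichols algebra. -/
theorem eq_zero_of_mem_borel
    (hgen : Subgroup.closure {g : G | ∃ s : Refl G, s.1 = g ∧ c s ≠ 0} = ⊤)
    {u : RestrCher c} (hu : u ∈ RestrCher.borel c) (h : R.restrRep hc u (R.delta 1 1) = 0) :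
    u = 0 := by
  classical
  have := Fintype.ofFinite G
  obtain ⟨p, rfl⟩ : ∃ p : G → FreeAlgebra ℂ V,
      u = ∑ g, FreeAlgebra.lift ℂ (RestrCher.vecₗ c) (p g) * RestrCher.grp c g := by
    clear h
    induction hu using Submodule.span_induction with
    | mem _ h =>
      obtain ⟨p, g, rfl⟩ := h
      refine ⟨Pi.single g p, ?_⟩
      rw [Finset.sum_eq_single g (fun h _ hh => by
        rw [Pi.single_eq_of_ne hh, map_zero, zero_mul]) (by simp), Pi.single_eq_same]
    | zero => exact ⟨0, by simp⟩
    | add _ _ _ _ hx hy =>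
      obtain ⟨p, rfl⟩ := hx
      obtain ⟨q, rfl⟩ := hy
      exact ⟨p + q, by simp only [Pi.add_apply, map_add, add_mul, Finset.sum_add_distrib]⟩
    | smul z _ _ hx =>
      obtain ⟨p, rfl⟩ := hx
      exact ⟨z • p, by simp only [Pi.smul_apply, map_smul, smul_mul_assoc, Finset.smul_sum]⟩
  refine Finset.sum_eq_zero fun k _ => ?_
  suffices hk : R.vecHom c (p k) ∈ R.rightRad by
    rw [RestrCher.lift_vec_eq_zero c (R.freeToSym_mem_span_of_vecHom c hc hgen hk), zero_mul]
  -- The group element `g` moves the support from `1` to `g`, so evaluation at `k` leaves only the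
  -- summand `g = k`.
  have hk := congrFun h k
  rw [map_sum, LinearMap.sum_apply, Finset.sum_apply, Finset.sum_eq_single k] at hk
  · rw [map_mul, Module.End.mul_apply, restrRep_vec, lift_opY_apply, restrRep_grp, opG_apply,
      inv_mul_cancel, delta, if_pos rfl, fockAct_mk, map_one, lift_fockMul_mk, mul_one,
      Pi.zero_apply, Submodule.Quotient.mk_eq_zero] at hk
    exact hk
  · intro g _ hg
    rw [map_mul, Module.End.mul_apply, restrRep_vec, lift_opY_apply, restrRep_grp, opG_apply,
      delta, if_neg (fun e => hg (inv_mul_eq_one.1 e)), map_zero, map_zero]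
  · simp

/-- Products of linear forms in the restricted Cherednik algebra are determined by their pairings
with words. -/
theorem exists_section (hgen : Subgroup.closure {s : G | IsReflection s} = ⊤) (d : ℕ) :
    ∃ τ : ((Fin d → Refl G) → ℂ) →ₗ[ℂ] RestrCher c, ∀ f : Fin d → Module.Dual ℂ V,
      τ (fun w => R.pair (R.covHom (covWord f)) (word w))
        = (List.ofFn fun k => RestrCher.covₗ c (f k)).prod := by
  let φ : ((Fin d → Module.Dual ℂ V) →₀ ℂ) →ₗ[ℂ] ((Fin d → Refl G) → ℂ) :=
    Finsupp.linearCombination ℂ fun f w => R.pair (R.covHom (covWord f)) (word w)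
  let ψ : ((Fin d → Module.Dual ℂ V) →₀ ℂ) →ₗ[ℂ] RestrCher c :=
    Finsupp.linearCombination ℂ fun f => (List.ofFn fun k => RestrCher.covₗ c (f k)).prod
  -- A combination `q` of products of forms that pairs to zero with all words has its image in the
  -- left radical. Then `q` lies in the ideal of positive-degree invariants, so it vanishes in the
  -- restricted algebra.
  have hker : LinearMap.ker φ ≤ LinearMap.ker ψ := by
    intro x hx
    let q := Finsupp.linearCombination ℂ (fun f : Fin d → Module.Dual ℂ V => covWord f) x
    have hψ : ψ x = FreeAlgebra.lift ℂ (RestrCher.covₗ c) q := by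
      simp only [ψ, q, Finsupp.linearCombination_apply, Finsupp.sum, map_sum, map_smul,
        lift_covWord]
    rw [LinearMap.mem_ker, hψ]
    refine RestrCher.lift_cov_eq_zero c (R.freeToSym_mem_span_of_covHom hgen fun b => ?_)
    choose a ha using R.exists_covHom_covWord (G := G) (n := d)
    obtain ⟨a', ha'⟩ : ∃ a', R.covHom q = wordSum (FreeAlgebra.ι ℂ) (n := d) a' := by
      refine ⟨∑ f ∈ x.support, x f • a f, ?_⟩
      rw [← wordSumₗ_apply]
      simp only [q, Finsupp.linearCombination_apply, Finsupp.sum, map_sum, map_smul, ha,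
        wordSumₗ_apply]
    have hw : ∀ w : Fin d → Refl G, R.pair (R.covHom q) (word w) = 0 := fun w => by
      have := congrFun (LinearMap.mem_ker.1 hx) w
      simpa [φ, q, Finsupp.linearCombination_apply, Finsupp.sum, pair, LinearMap.sum_apply]
        using this
    -- Words of length `d` suffice as tests, because `q` is homogeneous of degree `d` and other
    -- degrees are orthogonal to it.
    obtain ⟨S, b, rfl⟩ := exists_eq_sum_wordSum b
    rw [pair_sum_right]
    refine Finset.sum_eq_zero fun m _ => ?_
    rw [ha'] at hw ⊢
    rcases eq_or_ne d m with rfl | hm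
    · rw [pair_wordSum, Matrix.dotProduct_mulVec]
      have hv : a' ᵥ* braidedFactorial R.braiding d = 0 := by
        funext w
        have := hw w
        rwa [pair_wordSum, Matrix.dotProduct_mulVec, dotProduct_single_one] at this
      rw [hv, zero_dotProduct]
    · exact R.pair_wordSum_of_ne hm _ _
  obtain ⟨τ, hτ⟩ := exists_comp_eq_of_ker_le (H := RestrCher c) φ ψ hker
  refine ⟨τ, fun f => ?_⟩
  have := LinearMap.congr_fun hτ (Finsupp.single f 1)
  simpa [φ, ψ] using this

theorem restrRep_covDegree_of_lt {d m : ℕ} (hmd : m < d) {z : RestrCher c}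
    (hz : z ∈ RestrCher.covDegree c d) (g : G) (w : Fin m → Refl G) :
    R.restrRep hc z (R.delta g (word w)) = 0 := by
  induction hz using Submodule.span_induction with
  | mem _ h =>
    obtain ⟨u, _, f, rfl⟩ := h
    obtain ⟨a, ha⟩ := R.exists_covHom_covWord f
    rw [map_mul, Module.End.mul_apply, R.restrRep_covWord hc f ha,
      R.wordSum_opS_delta_of_lt hmd, map_zero]
  | zero => simp
  | add _ _ _ _ hx hy => rw [map_add, LinearMap.add_apply, hx, hy, add_zero]
  | smul z _ _ hx => rw [map_smul, LinearMap.smul_apply, hx, smul_zero]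

/-- With the section `τ`, `z` is a sum of terms `u_w τ(e_w)` with `u_w` in `S(V) ℂG`, and acting on
the word `w` gives `u_w` applied to the vacuum. Hence every `u_w` is zero. -/
theorem eq_zero_of_mem_covDegree (hgen : Subgroup.closure {s : G | IsReflection s} = ⊤)
    (hgen' : Subgroup.closure {g : G | ∃ s : Refl G, s.1 = g ∧ c s ≠ 0} = ⊤) {d : ℕ}
    {z : RestrCher c} (hz : z ∈ RestrCher.covDegree c d)
    (h : ∀ w : Fin d → Refl G, R.restrRep hc z (R.delta (wordProd w)⁻¹ (word w)) = 0) :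
    z = 0 := by
  obtain ⟨τ, hτ⟩ := R.exists_section (c := c) hgen d
  obtain ⟨u, hu, rfl, hu'⟩ : ∃ u : (Fin d → Refl G) → RestrCher c,
      (∀ w, u w ∈ RestrCher.borel c) ∧ z = ∑ w, u w * τ (Pi.single w 1) ∧
      ∀ w, R.restrRep hc z (R.delta (wordProd w)⁻¹ (word w))
        = R.restrRep hc (u w) (R.delta 1 1) := by
    clear h
    induction hz using Submodule.span_induction with
    | mem _ h =>
      obtain ⟨u, hu, f, rfl⟩ := h
      obtain ⟨a, ha⟩ := R.exists_covHom_covWord f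
      -- For `u` times a product of forms, the coefficient at `w` is `u` scaled by the pairing of
      -- that product with `w`.
      refine ⟨fun w => R.pair (R.covHom (covWord f)) (word w) • u,
        fun w => Submodule.smul_mem _ _ hu, ?_, fun w => ?_⟩
      · rw [← hτ f]
        conv_lhs => rw [pi_eq_sum_univ' (fun w => R.pair (R.covHom (covWord f)) (word w))]
        rw [map_sum, Finset.mul_sum]
        refine Finset.sum_congr rfl fun w _ => ?_
        rw [map_smul, mul_smul_comm, smul_mul_assoc]
      · rw [map_mul, Module.End.mul_apply, R.restrRep_covWord hc f ha, wordSum_opS_delta, map_smul,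
          map_smul, LinearMap.smul_apply, ha]
    | zero => exact ⟨0, fun w => zero_mem _, by simp, fun w => by simp⟩
    | add _ _ _ _ hx hy =>
      obtain ⟨u, hu, rfl, hu'⟩ := hx
      obtain ⟨v, hv, rfl, hv'⟩ := hy
      refine ⟨u + v, fun w => add_mem (hu w) (hv w), ?_, fun w => ?_⟩
      · simp only [Pi.add_apply, add_mul, Finset.sum_add_distrib]
      · rw [map_add, LinearMap.add_apply, hu', hv', Pi.add_apply, map_add, LinearMap.add_apply]
    | smul k _ _ hx =>
      obtain ⟨u, hu, rfl, hu'⟩ := hx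
      refine ⟨k • u, fun w => Submodule.smul_mem _ _ (hu w), ?_, fun w => ?_⟩
      · simp only [Pi.smul_apply, smul_mul_assoc, Finset.smul_sum]
      · rw [map_smul, LinearMap.smul_apply, hu', Pi.smul_apply, map_smul, LinearMap.smul_apply]
  refine Finset.sum_eq_zero fun w _ => ?_
  rw [R.eq_zero_of_mem_borel hc hgen' (hu w) (by rw [← hu', h]), zero_mul]

/-- The system is triangular: on words of length `d`, the components of degree above `d` act by
zero, and those below `d` already vanish by induction, so the component of degree `d` acts by zero
too. -/
theorem restrCherHom_injective (hgen : Subgroup.closure {s : G | IsReflection s} = ⊤)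
    (hgen' : Subgroup.closure {g : G | ∃ s : Refl G, s.1 = g ∧ c s ≠ 0} = ⊤) :
    Function.Injective (R.restrCherHom hc) := by
  refine (injective_iff_map_eq_zero _).2 fun z hz => ?_
  have hz' : R.restrRep hc z = 0 := by
    change R.fockRep (R.restrCherHom hc z) = 0
    rw [hz, map_zero]
  obtain ⟨f, hf, rfl⟩ := (Submodule.mem_iSup_iff_exists_finsupp _ _).1
    (RestrCher.mem_iSup_covDegree c z)
  suffices h : ∀ d, f d = 0 from Finset.sum_eq_zero fun d _ => h d
  intro d
  induction d using Nat.strong_induction_on with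
  | _ d ih =>
    refine R.eq_zero_of_mem_covDegree hc hgen hgen' (hf d) fun w => ?_
    have e := LinearMap.congr_fun hz' (R.delta (wordProd w)⁻¹ (word w))
    rw [Finsupp.sum, map_sum, LinearMap.sum_apply, LinearMap.zero_apply,
      Finset.sum_eq_single d] at e
    · exact e
    · intro m _ hm
      rcases lt_or_gt_of_ne hm with h | h
      · rw [ih m h, map_zero, LinearMap.zero_apply]
      · exact R.restrRep_covDegree_of_lt hc h (hf m) _ w
    · intro hd
      rw [Finsupp.notMem_support_iff.1 hd, map_zero, LinearMap.zero_apply]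

end RootData

end Faithful

end Cherednik

end

theorem mainTheorem2 {V : Type*} [AddCommGroup V] [Module ℂ V] [FiniteDimensional ℂ V]
    (G : Subgroup (LinearMap.GeneralLinearGroup ℂ V)) [Finite G]
    (hirr : (natRep G).IsIrreducible)
    (hgen : Subgroup.closure {s : G | IsReflection s} = ⊤)
    (R : RootData G) (c : Refl G → ℂ) (hc : ∀ (g : G) (s : Refl G), c (s.conj g) = c s) :
    (∃ M : RestrCher c →ₐ[ℂ] HeisDouble R,
      (∀ v : V, M (RestrCher.vec c v) =
        ∑ s : Refl G, (c s * R.root s v) • HeisDouble.y R s) ∧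
      (∀ f : Module.Dual ℂ V, M (RestrCher.cov c f) =
        ∑ s : Refl G, f (R.coroot s) • HeisDouble.ystar R s) ∧
      (∀ g : G, M (RestrCher.grp c g) = HeisDouble.grp R g) ∧
      ((∀ s, c s ≠ 0) → Function.Injective M) ∧
      (Subgroup.closure {g : G | ∃ s : Refl G, s.1 = g ∧ c s ≠ 0} = ⊤ → Function.Injective M)) ∧
    (∃ m : Coinvariant (natRep G) →ₐ[ℂ] Nichols R.braiding,
      (∀ v : V, m (Ideal.Quotient.mk _ (SymmetricAlgebra.ι ℂ V v)) =
        ∑ s : Refl G, (c s * R.root s v) • Nichols.gen R.braiding s) ∧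
      ((∀ s, c s ≠ 0) → Function.Injective m) ∧
      (Subgroup.closure {g : G | ∃ s : Refl G, s.1 = g ∧ c s ≠ 0} = ⊤ → Function.Injective m)) := by
  refine ⟨⟨R.restrCherHom hc, fun v => ?_, fun f => ?_, R.restrCherHom_grp hc,
    fun h => R.restrCherHom_injective hc hgen (RootData.closure_of_forall_ne_zero hgen h),
    R.restrCherHom_injective hc hgen⟩, ⟨R.coinvariantHom c hc, fun v => ?_,
    fun h => R.coinvariantHom_injective c hc (RootData.closure_of_forall_ne_zero hgen h),
    R.coinvariantHom_injective c hc⟩⟩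
  · rw [R.restrCherHom_vec, R.vecSum_apply]
  · rw [R.restrCherHom_cov, R.covSum_apply]
  · rw [← freeToSym_ι, R.coinvariantHom_mk, FreeAlgebra.lift_ι_apply, R.vecSum_apply]
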